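/- Let $p$ be a prime, let $q$ be a power of $p$ with $q>1$, let $F=\mathbb F_q((t))$ be the field of formal Laurent series over the finite field $\mathbb F_q$, with its $t$-adic topology, and let $F^-=\mathbb F_q[t^{-1}]\subset F$. Let $e=p^n$ with $n\ge 0$ be a power of $p$ (possibly $e=1$), and let $$G_2=\left\{\begin{pmatrix}1&y^e&z\\0&1&y\\0&0&1\end{pmatrix} : y,z\in F\right\}\subset \mathrm{GL}(3,F),$$ with the subspace topology. A subgroup $\Gamma$ of $G_2$ is \emph{arithmetic} if $\Gamma\cap \mathrm{GL}(3,F^-)$ has finite index both in $\Gamma$ and in $G_2\cap\mathrm{GL}(3,F^-)$; it is a \emph{lattice} if it is discrete and $G_2/\Gamma$ is compact. A \emph{virtual automorphism} of a topological group $G$ is an isomorphism of topological groups $\Lambda\colon G'\to G''$ between finite-index open subgroups $G',G''$ of $G$; for a discrete group $\Gamma$ this is just an isomorphism between finite-index subgroups of $\Gamma$. If $e\neq 2$, then every arithmetic lattice $\Gamma$ in $G_2$ is automorphism rigid in $G_2$: for every virtual automorphism $\lambda\colon\Gamma_1\to\Gamma_2$ of $\Gamma$ there exist a virtual automorphism $\Lambda\colon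 G'\to G''$ of $G_2$ and a finite-index subgroup $\Gamma'$ of $\Gamma_1$ such that $\Gamma'\subset G'$ and $\Lambda(\gamma)=\lambda(\gamma)$ for all $\gamma\in\Gamma'$. -/

import Mathlib

open scoped LaurentSeries MatrixGroups

noncomputable section

namespace ArithUnip

/-! ### Virtual isomorphisms and automorphism rigidity -/

/-- A virtual isomorphism from `G₁` to `G₂`: an isomorphism of topological groups between
finite-index, open subgroups of `G₁` and `G₂`. -/
structure VirtualIso (G₁ G₂ : Type*) [Group G₁] [TopologicalSpace G₁]
    [Group G₂] [TopologicalSpace G₂] where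
  /-- the domain -/
  dom : Subgroup G₁
  /-- the range -/
  cod : Subgroup G₂
  dom_finiteIndex : dom.FiniteIndex
  dom_isOpen : IsOpen (dom : Set G₁)
  cod_finiteIndex : cod.FiniteIndex
  cod_isOpen : IsOpen (cod : Set G₂)
  /-- the isomorphism -/
  iso : dom ≃ₜ* cod

/-- A virtual automorphism of `G`. -/
abbrev VirtualAut (G : Type*) [Group G] [TopologicalSpace G] := VirtualIso G G

/-- For subgroups `Γ₁ ≤ G₁` and `Γ₂ ≤ G₂`, the virtual isomorphism `Λ` from `G₁` to `G₂` virtually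
extends the virtual isomorphism `lam` from `Γ₁` to `Γ₂`: the two agree on some finite-index, open
subgroup `Γ'` that lies in both domains. (As `lam.dom` has finite index in `Γ₁` and is open in it,
it makes no difference whether `Γ'` is required to be finite-index and open in `lam.dom`
or in `Γ₁`.) -/
def VirtualIso.VirtuallyExtends {G₁ G₂ : Type*} [Group G₁] [TopologicalSpace G₁]
    [Group G₂] [TopologicalSpace G₂] {Γ₁ : Subgroup G₁} {Γ₂ : Subgroup G₂}
    (Λ : VirtualIso G₁ G₂) (lam : VirtualIso Γ₁ Γ₂) : Prop :=
  ∃ Γ' : Subgroup Γ₁, Γ'.FiniteIndex ∧ IsOpen (Γ' : Set Γ₁) ∧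
    ∀ γ ∈ Γ', ∃ (h : γ ∈ lam.dom) (h' : (γ : G₁) ∈ Λ.dom),
      ((Λ.iso ⟨(γ : G₁), h'⟩ : Λ.cod) : G₂) = ((lam.iso ⟨γ, h⟩ : lam.cod) : Γ₂)

/-- `Γ` is automorphism rigid in `G`: every virtual automorphism of `Γ` virtually extends to a
virtual automorphism of `G`. -/
def AutomorphismRigid {G : Type*} [Group G] [TopologicalSpace G] (Γ : Subgroup G) : Prop :=
  ∀ lam : VirtualAut Γ, ∃ Λ : VirtualAut G, Λ.VirtuallyExtends lam

/-- A (cocompact) lattice: a discrete subgroup with compact quotient. -/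
def IsLattice {G : Type*} [Group G] [TopologicalSpace G] (Γ : Subgroup G) : Prop :=
  DiscreteTopology Γ ∧ CompactSpace (G ⧸ Γ)

/-! ### Arithmetic subgroups over `K((t))` -/

/-- `F⁻ = K[t⁻¹]`, the `K`-subalgebra of `F = K((t))` generated by `t⁻¹`. -/
def Fminus (K : Type*) [Field K] : Subalgebra K K⸨X⸩ :=
  Algebra.adjoin K {(HahnSeries.single (-1 : ℤ) (1 : K) : K⸨X⸩)}

/-- `GL(m, F⁻)`, as a subgroup of `GL(m, F)`. -/
def GLminus (K : Type*) [Field K] (m : ℕ) : Subgroup (GL (Fin m) K⸨X⸩) :=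
  (Matrix.GeneralLinearGroup.map (n := Fin m) (Fminus K).val.toRingHom).range

/-- A subgroup `Γ` of `G ≤ GL(m, F)` is arithmetic if it is commensurable with
`GL(m, F⁻) ∩ G`. -/
def IsArithmetic {K : Type*} [Field K] {m : ℕ} {G : Subgroup (GL (Fin m) K⸨X⸩)}
    (Γ : Subgroup G) : Prop :=
  Subgroup.Commensurable Γ ((GLminus K m).subgroupOf G)

/-! ### The two-dimensional unipotent group -/

/-- The group of all matrices `(1, y^e, z; 0, 1, y; 0, 0, 1)` with `y, z ∈ F`, where `e = p ^ n`
is a power (possibly `1`) of the characteristic `p` of `F`. -/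
def G2 (F : Type*) [Field F] (p : ℕ) [Fact p.Prime] [CharP F p] (n : ℕ) :
    Subgroup (GL (Fin 3) F) where
  carrier := {g | ∃ y z : F, (g : Matrix (Fin 3) (Fin 3) F) =
    !![1, y ^ (p ^ n), z; 0, 1, y; 0, 0, 1]}
  one_mem' := by
    refine ⟨0, 0, ?_⟩
    have h0 : p ^ n ≠ 0 := pow_ne_zero _ (Fact.out : p.Prime).ne_zero
    rw [zero_pow h0]
    ext i j
    fin_cases i <;> fin_cases j <;> simp
  mul_mem' := by
    rintro a b ⟨y, z, ha⟩ ⟨y', z', hb⟩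
    refine ⟨y + y', z' + y ^ (p ^ n) * y' + z, ?_⟩
    rw [Units.val_mul, ha, hb, add_pow_char_pow]
    ext i j
    fin_cases i <;> fin_cases j <;> simp [Matrix.mul_apply, Fin.sum_univ_three, add_comm]
  inv_mem' := by
    rintro a ⟨y, z, ha⟩
    refine ⟨-y, y ^ (p ^ n) * y - z, ?_⟩
    have hneg : (-y) ^ (p ^ n) = -(y ^ (p ^ n)) := by
      have h0 : p ^ n ≠ 0 := pow_ne_zero _ (Fact.out : p.Prime).ne_zero
      have h := add_pow_char_pow (R := F) (p := p) (n := n) (-y) y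
      rw [neg_add_cancel, zero_pow h0] at h
      exact eq_neg_of_add_eq_zero_left h.symm
    rw [Matrix.coe_units_inv]
    apply Matrix.inv_eq_left_inv
    rw [ha, hneg]
    ext i j
    fin_cases i <;> fin_cases j <;> simp [Matrix.mul_apply, Fin.sum_univ_three]
    ring

instance charP_laurentSeries (K : Type*) [Field K] (p : ℕ) [CharP K p] : CharP K⸨X⸩ p :=
  charP_of_injective_algebraMap (algebraMap K K⸨X⸩).injective p

end ArithUnip

end

open scoped LaurentSeries MatrixGroups

noncomputable section

namespace ArithUnip

/-! Write `e = p ^ n`. If `e = 1` the group is abelian. Some open subgroup `U` meets the discrete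
group `Γ` trivially, cocompactness makes the product of `lam.dom` and `U` an open subgroup of finite
index, and `lam` times the identity of `U` is the extension (`automorphismRigid_of_comm`).

Let `e ≠ 1` and `R = K[X] ≅ F⁻`. Up to finite index, `lam` is an injective homomorphism `μ` between
finite-index subgroups of the integral points `Heis R p n`. It preserves the elements with `y = 0`,
so it induces an additive map `α` on the coordinates `y`, and commutators show that `α` respects
vanishing sums of brackets `f ^ e * g - g ^ e * f`. The crux is to recover the multiplication of `R`
from this. For a fixed `x`, a universal relation between four brackets says that, among germs of
additive maps along finite-index subgroups, `α` and its Frobenius twist are `Linked` by the operator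
`T` of multiplication by `x` in the argument. By `exists_eigenvalue` the germ of `α` is then an
eigenvector: `α (x * f) = θ * α f`. Since `bracket e (x * f) g + bracket e (x ^ e * g) f = (x ^ e ^
2 - x) * f * g ^ e`, it follows that `α` respects equalities of monomials `f * g ^ e`
(`exists_monomial_relations`), hence equalities of ratios (`cross_relation`), hence is a constant
multiple of a ring automorphism `σ` of `R` (`exists_ringEquiv_of_monomial_relations`).

Automorphisms of `K[X]` preserve degrees, so `σ` extends to a bicontinuous automorphism `S` of `F`
(`exists_continuous_ringEquiv`). Products of two commutators fill a finite-index part of the center,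
where `μ` must be `c ^ (e + 1) * S`. The remaining defect of `μ` in the coordinate `z` depends,
after passing to finite index, only on `y`. It extends to a continuous additive map `κ` because `F⁻`
meets the open maximal ideal trivially (`exists_continuous_addHom`). Then `(y, z) ↦ (c * S y, c ^ (e
+ 1) * S z + κ y)` is the required automorphism (`exists_extension`). -/

/-! ### A rigidity statement about a linear map and a commuting Frobenius-semilinear map -/

section Eigenvector

open Polynomial

variable {p n : ℕ} [Fact p.Prime] {E : Type*} [Field E] [CharP E p]
  {M : Type*} [AddCommGroup M] [Module E M]

/-- `(X - θ ^ e) * (θ - X ^ e)`. -/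
def linkPoly (e : ℕ) (θ : E) : E[X] := (X - C (θ ^ e)) * (C θ - X ^ e)

/-- For `b = Φ a`, the tensor `b ⊗ a - a ⊗ b` is killed by `(X - Y ^ e) * (Y - X ^ e)`, where `X`
and `Y` act as `T` on the two factors; this is expressed by contracting the second factor. -/
def Linked (e : ℕ) (T : Module.End E M) (a b : M) : Prop :=
  ∀ l : M →ₗ[E] E,
    l (T a) • T b - l a • (T ^ (e + 1)) b - l ((T ^ (e + 1)) a) • b + l ((T ^ e) a) • (T ^ e) b =
    l (T b) • T a - l b • (T ^ (e + 1)) a - l ((T ^ (e + 1)) b) • a + l ((T ^ e) b) • (T ^ e) a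

lemma Linked.symm {e : ℕ} {T : Module.End E M} {a b : M} (h : Linked e T a b) : Linked e T b a :=
  fun l => (h l).symm

lemma aeval_end_mul (T : Module.End E M) (P Q : E[X]) (v : M) :
    aeval T (P * Q) v = aeval T P (aeval T Q v) := by
  rw [map_mul]; rfl

lemma aeval_end_comm (T : Module.End E M) (P Q : E[X]) (v : M) :
    aeval T P (aeval T Q v) = aeval T Q (aeval T P v) := by
  rw [← aeval_end_mul, mul_comm, aeval_end_mul]

lemma aeval_end_of_eigen (T : Module.End E M) (P : E[X]) {v : M} {θ : E} (h : T v = θ • v) :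
    aeval T P v = P.eval θ • v := by
  induction P using Polynomial.induction_on' with
  | add P Q hP hQ => simp [hP, hQ, add_smul]
  | monomial k c =>
    have : ∀ k, (T ^ k) v = θ ^ k • v := by
      intro k
      induction k with
      | zero => simp
      | succ k ih => rw [pow_succ, Module.End.mul_apply, h, map_smul, ih, smul_smul, pow_succ,
          mul_comm]
    rw [aeval_monomial, eval_monomial]
    simp [this, smul_smul, Module.algebraMap_end_apply, mul_comm]

/-- If `B b = 0` and `B a ≠ 0` is an eigenvector for `θ`, then `linkPoly e θ` kills `b`. -/
lemma Linked.aeval_linkPoly_eq_zero {e : ℕ} {T : Module.End E M} {a b : M} (h : Linked e T a b)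
    (B : E[X]) (hb : aeval T B b = 0) {θ : E} (ha : aeval T B a ≠ 0)
    (hθ : T (aeval T B a) = θ • aeval T B a) : aeval T (linkPoly e θ) b = 0 := by
  obtain ⟨l, hl⟩ : ∃ l : M →ₗ[E] E, l (aeval T B a) ≠ 0 := by
    by_contra! hcon
    exact ha ((Module.forall_dual_apply_eq_zero_iff E _).1 hcon)
  have key : ∀ (Q : E[X]) (v : M), (l ∘ₗ aeval T B) (aeval T Q v) = l (aeval T Q (aeval T B v)) := by
    intro Q v
    rw [LinearMap.comp_apply, aeval_end_comm]
  have hpow : ∀ (k : ℕ) (v : M), (T ^ k) v = aeval T (X ^ k : E[X]) v := by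
    intro k v; simp
  have hT1 : ∀ v : M, T v = aeval T (X : E[X]) v := by
    intro v; simp
  -- The functional `l ∘ B(T)` kills every term in which it meets `b`, and turns powers of `T` on
  -- `a` into powers of `θ`.
  have := h (l ∘ₗ aeval T B)
  rw [hT1 a, hT1 b, hpow, hpow, hpow, hpow, key, key, key, key, key, key, hb,
    aeval_end_of_eigen T _ hθ, aeval_end_of_eigen T _ hθ, aeval_end_of_eigen T _ hθ] at this
  simp only [LinearMap.comp_apply, hb, map_zero, zero_smul, sub_zero, add_zero, map_smul,
    smul_eq_mul, eval_X, eval_pow] at this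
  have hP : linkPoly e θ = C θ * X - X ^ (e + 1) - C (θ ^ (e + 1)) + C (θ ^ e) * X ^ e := by
    simp only [linkPoly, map_pow]; ring
  have h2 : l (aeval T B a) • aeval T (linkPoly e θ) b = 0 := by
    rw [hP, ← this]
    simp only [map_add, map_sub, map_mul, aeval_X, aeval_C, LinearMap.add_apply,
      LinearMap.sub_apply, Module.End.mul_apply, smul_add, smul_sub,
      Module.algebraMap_end_apply, smul_smul]
    ring_nf
  exact (smul_eq_zero.1 h2).resolve_left hl

/-- The annihilator of a vector is generated by a polynomial. -/
lemma exists_annihilator (T : Module.End E M) (a : M) :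
    ∃ χ : E[X], ∀ Q : E[X], aeval T Q a = 0 ↔ χ ∣ Q := by
  let I : Ideal E[X] :=
    { carrier := {Q | aeval T Q a = 0}
      add_mem' := by intro P Q hP hQ; simp_all
      zero_mem' := by simp
      smul_mem' := by
        intro P Q hQ
        simp only [Set.mem_ofPred_eq, smul_eq_mul] at *
        rw [aeval_end_mul, hQ, map_zero] }
  refine ⟨Submodule.IsPrincipal.generator I, fun Q => ?_⟩
  rw [← Submodule.IsPrincipal.mem_iff_generator_dvd I]
  rfl

variable (Φ : M →+ M) {T : Module.End E M}

lemma frob_aeval (hΦs : ∀ (c : E) m, Φ (c • m) = c ^ p ^ n • Φ m) (hΦT : ∀ m, Φ (T m) = T (Φ m))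
    (Q : E[X]) (a : M) :
    Φ (aeval T Q a) = aeval T (Q.map (iterateFrobenius E p n)) (Φ a) := by
  induction Q using Polynomial.induction_on' with
  | add P Q hP hQ => simp [hP, hQ]
  | monomial k c =>
    have : ∀ k v, Φ ((T ^ k) v) = (T ^ k) (Φ v) := by
      intro k
      induction k with
      | zero => simp
      | succ k ih => intro v; rw [pow_succ, Module.End.mul_apply, ih, hΦT, Module.End.mul_apply]
    rw [aeval_monomial, map_monomial, aeval_monomial, Module.End.mul_apply, Module.End.mul_apply,
      Module.algebraMap_end_apply, Module.algebraMap_end_apply, hΦs, this, iterateFrobenius_def]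

/-- As `E` is perfect, Frobenius on coefficients is an automorphism of `E[X]`; it carries the
annihilator of `a` to that of `Φ a`. -/
lemma frob_annihilator [IsAlgClosed E] (hΦs : ∀ (c : E) m, Φ (c • m) = c ^ p ^ n • Φ m)
    (hΦT : ∀ m, Φ (T m) = T (Φ m)) (hΦ0 : ∀ m, Φ m = 0 → m = 0)
    {a : M} {χ : E[X]} (hχ : ∀ Q : E[X], aeval T Q a = 0 ↔ χ ∣ Q) (Q : E[X]) :
    aeval T Q (Φ a) = 0 ↔ χ.map (iterateFrobenius E p n) ∣ Q := by
  let φ : E[X] ≃+* E[X] := Polynomial.mapEquiv (iterateFrobeniusEquiv E p n)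
  have hφ : ∀ P : E[X], φ P = P.map (iterateFrobenius E p n) := fun P => rfl
  obtain ⟨P, rfl⟩ := φ.surjective Q
  rw [hφ, ← frob_aeval Φ hΦs hΦT, ← hφ, ← hφ, map_dvd_iff, ← hχ]
  exact ⟨hΦ0 _, fun h => by rw [h, map_zero]⟩

/-- In a finite nonempty set closed under `e`-th roots there is a fixed point of some
`e ^ k`-th power map. -/
lemma exists_pow_eq_self_of_finite {e : ℕ} {S : Set E} (hS : S.Finite) (hne : S.Nonempty)
    (h : ∀ θ ∈ S, ∃ η ∈ S, η ^ e = θ) : ∃ η ∈ S, ∃ k, 1 ≤ k ∧ η ^ e ^ k = η := by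
  choose g hgS hg using h
  let G : S → S := fun θ => ⟨g θ θ.2, hgS θ θ.2⟩
  have hG : ∀ k (θ : S), ((G^[k] θ : S) : E) ^ e ^ k = θ := by
    intro k
    induction k with
    | zero => intro θ; simp
    | succ k ih =>
      intro θ
      rw [Function.iterate_succ_apply', pow_succ, mul_comm, pow_mul, hg _ (Subtype.coe_prop _), ih]
  obtain ⟨θ₀, h₀⟩ := hne
  have : Finite S := hS
  obtain ⟨i, j, hij, heq⟩ := Finite.exists_ne_map_eq_of_infinite fun k : ℕ => G^[k] ⟨θ₀, h₀⟩
  wlog hlt : i < j generalizing i j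
  · exact this j i hij.symm heq.symm (by omega)
  obtain ⟨k, rfl⟩ := Nat.exists_eq_add_of_lt hlt
  refine ⟨G^[i] ⟨θ₀, h₀⟩, Subtype.coe_prop _, k + 1, by omega, ?_⟩
  have := hG (k + 1) (G^[i] ⟨θ₀, h₀⟩)
  rwa [← Function.iterate_add_apply, show k + 1 + i = i + k + 1 by ring, ← heq] at this

/-- The torsion case: if `a` is killed by a nonzero polynomial in `T`, it is an eigenvector. -/
lemma eigenvector_of_torsion [IsAlgClosed E] (hΦs : ∀ (c : E) m, Φ (c • m) = c ^ p ^ n • Φ m)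
    (hΦT : ∀ m, Φ (T m) = T (Φ m)) (hΦ0 : ∀ m, Φ m = 0 → m = 0)
    (hT : ∀ k, 1 ≤ k → ∀ v, (T ^ (p ^ n) ^ k) v = T v → v = 0) {a : M} (ha : a ≠ 0)
    (hrel : Linked (p ^ n) T a (Φ a)) {Q : E[X]} (hQ0 : Q ≠ 0) (hQ : aeval T Q a = 0) :
    ∃ θ : E, T a = θ • a := by
  obtain ⟨χ, hχ⟩ := exists_annihilator T a
  have hχ0 : χ ≠ 0 := by
    rintro rfl
    exact hQ0 (zero_dvd_iff.1 ((hχ Q).1 hQ))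
  have hχa : aeval T χ a = 0 := (hχ χ).2 dvd_rfl
  have hχb := frob_annihilator Φ hΦs hΦT hΦ0 hχ
  set e := p ^ n with he
  have he0 : e ≠ 0 := pow_ne_zero _ (Fact.out : p.Prime).ne_zero
  have hinj : ∀ z w : E, z ^ e = w ^ e → z = w := fun z w h =>
    (iterateFrobenius E p n).injective (by simpa [iterateFrobenius_def] using h)
  have hmapeval : ∀ (P : E[X]) z, (P.map (iterateFrobenius E p n)).eval (z ^ e) = (P.eval z) ^ e := by
    intro P z
    have := Polynomial.eval_map_apply (f := iterateFrobenius E p n) (p := P) z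
    simpa [iterateFrobenius_def] using this
  have hlink : ∀ θ z : E, (linkPoly e θ).eval z = (z - θ ^ e) * (θ - z ^ e) := by
    intro θ z; simp [linkPoly]
  -- eigenvectors attached to roots
  have hroot : ∀ θ χ', χ = (X - C θ) * χ' →
      aeval T χ' a ≠ 0 ∧ T (aeval T χ' a) = θ • aeval T χ' a := by
    intro θ χ' h
    constructor
    · rw [Ne, hχ]
      intro hd
      have h1 : χ' ≠ 0 := by rintro rfl; simp at h; exact hχ0 h
      have h2 := Polynomial.natDegree_le_of_dvd hd h1
      rw [h, Polynomial.natDegree_mul (X_sub_C_ne_zero θ) h1, natDegree_X_sub_C] at h2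
      omega
    · have : aeval T (X - C θ) (aeval T χ' a) = 0 := by rw [← aeval_end_mul, ← h, hχa]
      simpa [sub_eq_zero, Module.algebraMap_end_apply] using this
  have hfac : ∀ θ, χ.IsRoot θ → ∃ χ', χ = (X - C θ) * χ' := fun θ h => dvd_iff_isRoot.2 h
  -- A root periodic under `e`-th powers would have an eigenvector with `T ^ e ^ k v = T v`, against
  -- `hT`.
  have hper : ∀ θ, χ.IsRoot θ → ∀ k, 1 ≤ k → θ ^ e ^ k ≠ θ := by
    intro θ hθ k hk h
    obtain ⟨χ', h'⟩ := hfac θ hθ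
    obtain ⟨h1, h2⟩ := hroot θ χ' h'
    apply h1
    apply hT k hk
    have := aeval_end_of_eigen T (X ^ e ^ k) h2
    simp only [map_pow, aeval_X, eval_pow, eval_X, h] at this
    rw [this, h2]
  -- The Frobenius twist of `χ`, times `χ'`, kills `Φ a`; it sends `a` to a `θ`-eigenvector, nonzero
  -- because the twist does not vanish at `θ`.
  have F1 : ∀ θ, χ.IsRoot θ → (∀ η, χ.IsRoot η → η ^ e ≠ θ) →
      χ.map (iterateFrobenius E p n) ∣ linkPoly e θ := by
    intro θ hθ hno
    obtain ⟨χ', h'⟩ := hfac θ hθ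
    obtain ⟨h1, h2⟩ := hroot θ χ' h'
    rw [← hχb]
    have hev : (χ.map (iterateFrobenius E p n)).eval θ ≠ 0 := by
      obtain ⟨w, rfl⟩ := IsAlgClosed.exists_pow_nat_eq θ (Nat.pos_of_ne_zero he0)
      rw [hmapeval]
      exact pow_ne_zero _ fun h => hno w h rfl
    have h3 : aeval T (χ.map (iterateFrobenius E p n) * χ') a =
        (χ.map (iterateFrobenius E p n)).eval θ • aeval T χ' a := by
      rw [aeval_end_mul, aeval_end_of_eigen T _ h2]
    refine hrel.aeval_linkPoly_eq_zero (χ.map (iterateFrobenius E p n) * χ') ?_ ?_ ?_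
    · rw [hχb]; exact dvd_mul_right _ _
    · rw [h3]; exact smul_ne_zero hev h1
    · rw [h3, map_smul, h2, smul_comm]
  -- The mirror image of `F1`: `a` and `Φ a` change roles and the eigenvalue is `θ ^ e`.
  have F2 : ∀ θ, χ.IsRoot θ → ¬ χ.IsRoot (θ ^ e) → χ ∣ linkPoly e (θ ^ e) := by
    intro θ hθ hno
    obtain ⟨χ', h'⟩ := hfac θ hθ
    obtain ⟨h1, h2⟩ := hroot θ χ' h'
    have h1' : aeval T (χ'.map (iterateFrobenius E p n)) (Φ a) ≠ 0 := by
      rw [← frob_aeval Φ hΦs hΦT]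
      exact fun h => h1 (hΦ0 _ h)
    have h2' : T (aeval T (χ'.map (iterateFrobenius E p n)) (Φ a)) =
        θ ^ e • aeval T (χ'.map (iterateFrobenius E p n)) (Φ a) := by
      rw [← frob_aeval Φ hΦs hΦT, ← hΦT, h2, hΦs]
    have h3 : aeval T (χ * χ'.map (iterateFrobenius E p n)) (Φ a) =
        χ.eval (θ ^ e) • aeval T (χ'.map (iterateFrobenius E p n)) (Φ a) := by
      rw [aeval_end_mul, aeval_end_of_eigen T _ h2']
    rw [← hχ]
    refine hrel.symm.aeval_linkPoly_eq_zero (χ * χ'.map (iterateFrobenius E p n)) ?_ ?_ ?_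
    · rw [hχ]; exact dvd_mul_right _ _
    · rw [h3]; exact smul_ne_zero hno h1'
    · rw [h3, map_smul, h2', smul_comm]
  -- a root that is not the `e`-th power of a root
  have hχnu : ¬ IsUnit χ := by
    intro hu
    apply ha
    have := (hχ 1).2 hu.dvd
    simpa using this
  obtain ⟨θ₀, hθ₀⟩ : ∃ θ₀, χ.IsRoot θ₀ :=
    IsAlgClosed.exists_root χ fun h => hχnu (isUnit_iff_degree_eq_zero.2 h)
  obtain ⟨θ, hθ, hno⟩ : ∃ θ, χ.IsRoot θ ∧ ∀ η, χ.IsRoot η → η ^ e ≠ θ := by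
    by_contra! hcon
    obtain ⟨η, h1, k, h2, h3⟩ := exists_pow_eq_self_of_finite (e := e) (S := {θ | χ.IsRoot θ})
      (Polynomial.finite_setOfPred_isRoot hχ0) ⟨θ₀, hθ₀⟩ hcon
    exact hper η h1 k h2 h3
  have hF1 := F1 θ hθ hno
  have hA : ∀ η, χ.IsRoot η → η = θ ∨ θ = η ^ e ^ 2 := by
    intro η hη
    have h1 : (linkPoly e θ).eval (η ^ e) = 0 := by
      refine eval_eq_zero_of_dvd_of_eval_eq_zero hF1 ?_
      rw [hmapeval, hη, zero_pow he0]
    rw [hlink, mul_eq_zero, sub_eq_zero, sub_eq_zero, ← pow_mul, ← pow_two] at h1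
    exact h1.imp (hinj _ _) id
  have hθe : ¬ χ.IsRoot (θ ^ e) := by
    intro h
    rcases hA _ h with h1 | h1
    · exact hper θ hθ 1 le_rfl (by simpa using h1)
    · refine hper θ hθ 3 (by norm_num) ?_
      rw [← pow_mul, ← pow_succ'] at h1
      exact h1.symm
  have hB : ∀ η, χ.IsRoot η → η = θ := by
    intro η hη
    have h1 : (linkPoly e (θ ^ e)).eval η = 0 :=
      eval_eq_zero_of_dvd_of_eval_eq_zero (F2 θ hθ hθe) hη
    rw [hlink, mul_eq_zero, sub_eq_zero, sub_eq_zero, ← pow_mul, ← pow_two] at h1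
    rcases h1 with h1 | h1
    · rcases hA η hη with h2 | h2
      · exact h2
      · rw [h1, ← pow_mul, ← pow_add] at h2
        exact (hper θ hθ (2 + 2) (by norm_num) h2.symm).elim
    · exact (hinj _ _ h1).symm
  obtain ⟨χ', h'⟩ := hfac θ hθ
  have hχ'0 : χ' ≠ 0 := by rintro rfl; simp at h'; exact hχ0 h'
  -- A double root `η` of `χ` makes `(X - η ^ e) ^ 2` divide `linkPoly e η`, so `η ^ e ^ 2 = η`,
  -- against `hper`.
  have hdeg : χ'.degree = 0 := by
    by_contra hd
    obtain ⟨η, hη⟩ := IsAlgClosed.exists_root χ' hd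
    have : η = θ := hB η (by rw [h', IsRoot, eval_mul, hη, mul_zero])
    subst this
    obtain ⟨χ'', h''⟩ := dvd_iff_isRoot.2 hη
    have h3 : (X - C (η ^ e)) * (X - C (η ^ e)) ∣ linkPoly e η := by
      refine dvd_trans ?_ hF1
      rw [h', h'', ← mul_assoc, Polynomial.map_mul]
      refine dvd_trans ?_ (dvd_mul_right _ _)
      simp [iterateFrobenius_def, he]
    rw [linkPoly, mul_dvd_mul_iff_left (X_sub_C_ne_zero _), dvd_iff_isRoot] at h3
    simp only [IsRoot, eval_sub, eval_C, eval_pow, eval_X, sub_eq_zero, ← pow_mul, ← pow_two] at h3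
    exact hper η hθ 2 (by norm_num) h3.symm
  rw [eq_C_of_degree_eq_zero hdeg] at h' hχ'0
  obtain ⟨h1, h2⟩ := hroot θ _ h'
  have hc : χ'.coeff 0 ≠ 0 := fun h => hχ'0 (by rw [h, C_0])
  refine ⟨θ, ?_⟩
  simp only [aeval_C, Module.algebraMap_end_apply, map_smul] at h2
  rw [smul_comm] at h2
  exact smul_right_injective M hc h2

/-- The torsion-free case does not occur. -/
lemma exists_torsion (hp : p ^ n ≠ 1) {a b : M} (hrel : Linked (p ^ n) T a b)
    (ha : a ≠ 0) (hc : ∀ c : E, b ≠ c • a) : ∃ Q : E[X], Q ≠ 0 ∧ aeval T Q a = 0 := by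
  by_contra! hcon
  set e := p ^ n with he
  have he2 : 2 ≤ e := by
    have : e ≠ 0 := pow_ne_zero _ (Fact.out : p.Prime).ne_zero
    omega
  let L₀ : E[X] →ₗ[E] M := (LinearMap.applyₗ a) ∘ₗ (aeval T).toLinearMap
  have hL : ∀ Q, L₀ Q = aeval T Q a := fun Q => rfl
  obtain ⟨g, hg⟩ := LinearMap.exists_leftInverse_of_injective L₀ (by
    rw [LinearMap.ker_eq_bot']
    intro Q hQ
    by_contra h
    exact hcon Q h hQ)
  have hg' : ∀ Q, g (aeval T Q a) = Q := fun Q => by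
    rw [← hL, ← LinearMap.comp_apply, hg]; rfl
  have hpow : ∀ (k : ℕ), g ((T ^ k) a) = X ^ k := by
    intro k; rw [← hg' (X ^ k)]; simp
  have hT1 : g (T a) = X := by rw [← hg' X]; simp
  have hg1 : g a = 1 := by rw [← hg' 1]; simp
  -- Among the coefficients on the left of `Linked`, the functional reading off `X ^ (e + 1)` sees
  -- only `T ^ (e + 1) a`. This isolates `b` as an element of `E[T] a`.
  obtain ⟨r, hr⟩ : ∃ r : E[X], b = aeval T r a := by
    have := hrel (lcoeff E (e + 1) ∘ₗ g)
    simp only [LinearMap.comp_apply, hpow, hT1, hg1, lcoeff_apply, coeff_X_pow, coeff_X,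
      coeff_one] at this
    rw [if_neg (by omega), if_neg (by omega), if_pos trivial, if_neg (by omega)] at this
    simp only [zero_smul, one_smul, zero_sub, sub_zero, add_zero] at this
    generalize (g (T b)).coeff (e + 1) = c1 at this
    generalize (g b).coeff (e + 1) = c2 at this
    generalize (g ((T ^ (e + 1)) b)).coeff (e + 1) = c3 at this
    generalize (g ((T ^ e) b)).coeff (e + 1) = c4 at this
    refine ⟨-(C c1 * X - C c2 * X ^ (e + 1) - C c3 + C c4 * X ^ e), ?_⟩
    rw [map_neg, LinearMap.neg_apply, eq_neg_iff_add_eq_zero, add_comm, ← eq_neg_iff_add_eq_zero,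
      this]
    simp [Module.algebraMap_end_apply]
  have hbpow : ∀ k : ℕ, g ((T ^ k) b) = X ^ k * r := by
    intro k; rw [← hg' (X ^ k * r), hr]; simp
  have hTb : g (T b) = X * r := by rw [← hg' (X * r), hr]; simp
  have hb : g b = r := by rw [← hg' r, hr]
  rcases Nat.eq_zero_or_pos r.natDegree with hd | hd
  · rw [eq_C_of_natDegree_eq_zero hd] at hr
    exact hc (r.coeff 0) (by rw [hr]; simp [Module.algebraMap_end_apply])
  -- In this degree the only surviving term of `Linked` is the leading coefficient of `r` times `a`.
  · have := hrel (lcoeff E (r.natDegree + (e + 1)) ∘ₗ g)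
    simp only [LinearMap.comp_apply, hpow, hT1, hg1, lcoeff_apply, coeff_X_pow, coeff_X,
      coeff_one, hbpow, hTb, hb] at this
    rw [if_neg (by omega), if_neg (by omega), if_neg (by omega), if_neg (by omega),
      coeff_eq_zero_of_natDegree_lt (p := r) (by omega),
      coeff_eq_zero_of_natDegree_lt (p := X * r) (by
        refine lt_of_le_of_lt natDegree_mul_le ?_
        rw [natDegree_X]; omega),
      coeff_eq_zero_of_natDegree_lt (p := X ^ e * r) (by
        refine lt_of_le_of_lt natDegree_mul_le ?_
        rw [natDegree_X_pow]; omega), coeff_X_pow_mul] at this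
    simp only [zero_smul, sub_self, add_zero, zero_sub, zero_eq_neg, smul_eq_zero] at this
    rcases this with h | h
    · have h0 : r = 0 := leadingCoeff_eq_zero.1 h
      rw [h0] at hd
      simp at hd
    · exact ha h

theorem exists_eigenvalue [IsAlgClosed E] (hp : p ^ n ≠ 1) (hΦs : ∀ (c : E) m, Φ (c • m) = c ^ p ^ n • Φ m)
    (hΦT : ∀ m, Φ (T m) = T (Φ m)) (hΦ0 : ∀ m, Φ m = 0 → m = 0)
    (hT : ∀ k, 1 ≤ k → ∀ v, (T ^ (p ^ n) ^ k) v = T v → v = 0) {a : M} (ha : a ≠ 0)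
    (hc : ∀ c : E, Φ a ≠ c • a) (hrel : Linked (p ^ n) T a (Φ a)) :
    ∃ θ : E, T a = θ • a := by
  obtain ⟨Q, hQ0, hQ⟩ := exists_torsion hp hrel ha hc
  exact eigenvector_of_torsion Φ hΦs hΦT hΦ0 hT ha hrel hQ0 hQ

end Eigenvector

/-! ### Germs of additive maps along finite-index subgroups -/

section Germs

variable {A : Type*} [AddCommGroup A]

/-- The commutator form of `G2`. -/
def bracket {R : Type*} [Ring R] (e : ℕ) (u v : R) : R := u ^ e * v - v ^ e * u

lemma finiteIndex_of_le_ker {B : Type*} [AddCommGroup B] {f : A →+ B} {W : AddSubgroup A}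
    [W.FiniteIndex] (h : ∀ w ∈ W, f w = 0) : f.ker.FiniteIndex :=
  AddSubgroup.finiteIndex_of_le (H := W) fun w hw => h w hw

lemma finiteIndex_comap {B : Type*} [AddCommGroup B] (f : A →+ B) (W : AddSubgroup B)
    [W.FiniteIndex] : (W.comap f).FiniteIndex :=
  ⟨by rw [AddSubgroup.index_comap]; exact (W.instFiniteIndex_addSubgroupOf f.range).index_ne_zero⟩

lemma finiteIndex_of_relIndex {V W : AddSubgroup A} (h : V.relIndex W ≠ 0) [hW : W.FiniteIndex] :
    V.FiniteIndex :=
  ⟨by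
    rw [← AddSubgroup.relIndex_top_right]
    refine AddSubgroup.relIndex_ne_zero_trans h ?_
    rw [AddSubgroup.relIndex_top_right]
    exact hW.index_ne_zero⟩

variable (A) (E : Type*) [Field E]

/-- The additive maps that vanish on a subgroup of finite index. -/
def negligible : Submodule E (A →+ E) where
  carrier := {f | f.ker.FiniteIndex}
  zero_mem' := finiteIndex_of_le_ker (W := ⊤) fun _ _ => rfl
  add_mem' := by
    intro f g (hf : f.ker.FiniteIndex) (hg : g.ker.FiniteIndex)
    refine finiteIndex_of_le_ker (W := f.ker ⊓ g.ker) fun w hw => ?_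
    rw [AddMonoidHom.add_apply, AddMonoidHom.mem_ker.1 hw.1, AddMonoidHom.mem_ker.1 hw.2, add_zero]
  smul_mem' := by
    intro c f (hf : f.ker.FiniteIndex)
    refine finiteIndex_of_le_ker (W := f.ker) fun w hw => ?_
    rw [AddMonoidHom.smul_apply, AddMonoidHom.mem_ker.1 hw, smul_zero]

variable {A E}

lemma mem_negligible {f : A →+ E} : f ∈ negligible A E ↔ f.ker.FiniteIndex := Iff.rfl

/-- Precomposition with an endomorphism. -/
def precomp (x : AddMonoid.End A) : (A →+ E) →ₗ[E] (A →+ E) where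
  toFun f := f.comp x
  map_add' _ _ := rfl
  map_smul' _ _ := rfl

lemma precomp_negligible (x : AddMonoid.End A) :
    negligible A E ≤ (negligible A E).comap (precomp x) := by
  intro f (hf : f.ker.FiniteIndex)
  have : (f.ker.comap x).FiniteIndex := finiteIndex_comap x f.ker
  exact finiteIndex_of_le_ker (W := f.ker.comap x) fun w hw => hw

/-- The action of an endomorphism on germs. -/
def germShift (x : AddMonoid.End A) : Module.End E ((A →+ E) ⧸ negligible A E) :=
  (negligible A E).mapQ (negligible A E) (precomp x) (precomp_negligible x)

lemma germShift_mk (x : AddMonoid.End A) (f : A →+ E) :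
    germShift x ((negligible A E).mkQ f) = (negligible A E).mkQ (f.comp x) := rfl

lemma germShift_pow_mk (x : AddMonoid.End A) (k : ℕ) (f : A →+ E) :
    (germShift x ^ k) ((negligible A E).mkQ f) = (negligible A E).mkQ (f.comp (x ^ k)) := by
  induction k generalizing f with
  | zero => rfl
  | succ k ih => rw [pow_succ, Module.End.mul_apply, germShift_mk, ih]; rw [pow_succ']; rfl

lemma mkQ_eq_zero_iff {f : A →+ E} : (negligible A E).mkQ f = 0 ↔ f.ker.FiniteIndex := by
  rw [Submodule.mkQ_apply, Submodule.Quotient.mk_eq_zero, mem_negligible]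

lemma mkQ_eq_zero_of_forall {f : A →+ E} (W : AddSubgroup A) [W.FiniteIndex]
    (h : ∀ w ∈ W, f w = 0) : (negligible A E).mkQ f = 0 :=
  mkQ_eq_zero_iff.2 (finiteIndex_of_le_ker h)

variable (p n : ℕ) [Fact p.Prime] [CharP E p]

lemma frob_comp_negligible (f : A →+ E) :
    ((iterateFrobenius E p n : E →+ E).comp f).ker.FiniteIndex ↔ f.ker.FiniteIndex := by
  have : ((iterateFrobenius E p n : E →+ E).comp f).ker = f.ker := by
    ext w
    simp [AddMonoidHom.mem_ker]
  rw [this]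

/-- The Frobenius on germs. -/
def germFrob : ((A →+ E) ⧸ negligible A E) →+ ((A →+ E) ⧸ negligible A E) :=
  QuotientAddGroup.map _ _ (AddMonoidHom.compHom (iterateFrobenius E p n : E →+ E))
    fun f hf => (frob_comp_negligible p n f).2 hf

lemma germFrob_mk (f : A →+ E) : germFrob p n ((negligible A E).mkQ f) =
    (negligible A E).mkQ ((iterateFrobenius E p n : E →+ E).comp f) := rfl

/-- Each algebraic hypothesis of `exists_eigenvalue` becomes a finite-index statement about kernels,
and the pointwise relation `hrel` becomes `Linked`. -/
theorem exists_eigenvalue_germ [IsAlgClosed E] (hp : p ^ n ≠ 1) (x : AddMonoid.End A)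
    (hx : ∀ k, 1 ≤ k → (AddMonoidHom.range (x ^ (p ^ n) ^ k - x)).FiniteIndex)
    (W : AddSubgroup A) [W.FiniteIndex] (α : A →+ E) (hα : ¬ α.ker.FiniteIndex)
    (hrel : ∀ f ∈ W, ∀ g ∈ W, bracket (p ^ n) (α (x f)) (α (x g)) -
      bracket (p ^ n) (α ((x ^ (p ^ n + 1)) f)) (α g) -
      bracket (p ^ n) (α f) (α ((x ^ (p ^ n + 1)) g)) +
      bracket (p ^ n) (α ((x ^ p ^ n) f)) (α ((x ^ p ^ n) g)) = 0) :
    ∃ θ : E, ∃ W' : AddSubgroup A, W'.FiniteIndex ∧ ∀ f ∈ W', α (x f) = θ * α f := by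
  let π := (negligible A E).mkQ
  suffices h : ∃ θ : E, germShift x (π α) = θ • π α by
    obtain ⟨θ, hθ⟩ := h
    refine ⟨θ, (α.comp x - θ • α).ker, ?_, fun f hf => ?_⟩
    · rw [← mkQ_eq_zero_iff, map_sub, map_smul, ← germShift_mk, hθ, sub_self]
    · exact sub_eq_zero.1 (AddMonoidHom.mem_ker.1 hf)
  refine exists_eigenvalue (p := p) (n := n) (germFrob p n) hp ?_ ?_ ?_ ?_ ?_ ?_ ?_
  · intro c m
    obtain ⟨f, rfl⟩ := (negligible A E).mkQ_surjective m
    rw [← map_smul, germFrob_mk, germFrob_mk, ← map_smul]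
    congr 1
    ext w
    simp [iterateFrobenius_def, mul_pow]
  · intro m
    obtain ⟨f, rfl⟩ := (negligible A E).mkQ_surjective m
    rfl
  · intro m hm
    obtain ⟨f, rfl⟩ := (negligible A E).mkQ_surjective m
    rw [germFrob_mk, mkQ_eq_zero_iff, frob_comp_negligible, ← mkQ_eq_zero_iff] at hm
    exact hm
  -- If `f ∘ (x ^ e ^ k - x)` is negligible, then `f` vanishes on a finite-index subgroup of the
  -- range of `x ^ e ^ k - x`, which itself has finite index.
  · intro k hk m hm
    obtain ⟨f, rfl⟩ := (negligible A E).mkQ_surjective m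
    rw [germShift_mk, germShift_pow_mk, ← sub_eq_zero, ← map_sub, mkQ_eq_zero_iff] at hm
    rw [mkQ_eq_zero_iff]
    let y : A →+ A := x ^ (p ^ n) ^ k - x
    have h1 : (f.comp (x ^ (p ^ n) ^ k) - f.comp x).ker = f.ker.comap y := by
      ext w
      change f ((x ^ (p ^ n) ^ k) w) - f (x w) = 0 ↔ f ((x ^ (p ^ n) ^ k) w - x w) = 0
      rw [map_sub]
    rw [h1] at hm
    have hy : y.range.FiniteIndex := hx k hk
    have h2 : f.ker.relIndex y.range ≠ 0 := by
      rw [AddMonoidHom.range_eq_map, ← AddSubgroup.relIndex_comap, AddSubgroup.relIndex_top_right]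
      exact hm.index_ne_zero
    exact finiteIndex_of_relIndex h2
  · rw [Ne, mkQ_eq_zero_iff]
    exact hα
  -- If `α ^ e = c * α` on a finite-index subgroup, the values of `α` there are among the finitely
  -- many roots of `X ^ e - c * X`, so `α` is negligible.
  · intro c hc
    rw [germFrob_mk, ← map_smul, ← sub_eq_zero, ← map_sub, mkQ_eq_zero_iff] at hc
    apply hα
    set K := ((iterateFrobenius E p n : E →+ E).comp α - c • α).ker
    have he1 : 1 < p ^ n := by
      have : p ^ n ≠ 0 := pow_ne_zero _ (Fact.out : p.Prime).ne_zero
      omega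
    have hfin : (α.comp K.subtype).range.carrier.Finite := by
      have hq : (Polynomial.X ^ p ^ n - Polynomial.C c * Polynomial.X : Polynomial E) ≠ 0 := by
        intro h
        have := congrArg (fun q => Polynomial.coeff q (p ^ n)) h
        simp [Polynomial.coeff_X, he1.ne] at this
      refine (Polynomial.finite_setOfPred_isRoot hq).subset ?_
      rintro _ ⟨⟨w, hw⟩, rfl⟩
      have := AddMonoidHom.mem_ker.1 hw
      simpa [iterateFrobenius_def] using this
    have : Finite (α.comp K.subtype).range := hfin
    have h1 : (α.comp K.subtype).ker.FiniteIndex := AddSubgroup.finiteIndex_ker _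
    have h2 : α.ker.relIndex K ≠ 0 := by
      have := h1.index_ne_zero
      rwa [← AddMonoidHom.comap_ker] at this
    exact finiteIndex_of_relIndex h2
  · intro l
    change _ = (_ : (A →+ E) ⧸ negligible A E)
    dsimp only [π]
    rw [germFrob_mk]
    set β := (iterateFrobenius E p n : E →+ E).comp α with hβ
    have hcomp : ∀ (f : A →+ E) (z : AddMonoid.End A) w, (f.comp z) w = f (z w) :=
      fun _ _ _ => rfl
    have hβa : ∀ w, β w = α w ^ p ^ n := fun w => by simp [hβ, iterateFrobenius_def]
    simp only [germShift_pow_mk, germShift_mk]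
    rw [← sub_eq_zero]
    simp only [← map_smul, ← map_sub, ← map_add]
    refine mkQ_eq_zero_of_forall W fun f hf => ?_
    -- For fixed `f` the relation holds for all `g` in `W`, so it is an equation of germs in `g`.
    -- Applying `l` leaves an equation in `f`, and that is again one of germs.
    have h0 : π (β (x f) • α.comp x - β ((x ^ (p ^ n + 1)) f) • α - β f • α.comp (x ^ (p ^ n + 1)) +
        β ((x ^ p ^ n) f) • α.comp (x ^ p ^ n) -
        (α (x f) • β.comp x - α ((x ^ (p ^ n + 1)) f) • β - α f • β.comp (x ^ (p ^ n + 1)) +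
        α ((x ^ p ^ n) f) • β.comp (x ^ p ^ n))) = 0 := by
      refine mkQ_eq_zero_of_forall W fun g hg => ?_
      have := hrel f hf g hg
      simp only [bracket] at this
      simp only [AddMonoidHom.sub_apply, AddMonoidHom.add_apply, AddMonoidHom.smul_apply,
        hcomp, hβa, smul_eq_mul]
      linear_combination this
    have h1 := congrArg l h0
    simp only [map_sub, map_add, map_smul, map_zero, smul_eq_mul] at h1
    simp only [AddMonoidHom.sub_apply, AddMonoidHom.add_apply, AddMonoidHom.smul_apply,
        hcomp, smul_eq_mul]
    dsimp only [π] at h1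
    linear_combination h1

end Germs

/-! ### From the commutator form to a ring automorphism -/

section RingAut

/-- A domain in which every nonzero multiple of the ring has finite index. -/
def FiniteQuotients (R : Type*) [CommRing R] : Prop :=
  ∀ r : R, r ≠ 0 → (AddMonoidHom.mulLeft r).range.FiniteIndex

variable {R : Type*} [CommRing R]

lemma finiteIndex_comap_mul (u : R) (W : AddSubgroup R) [W.FiniteIndex] :
    (W.comap (AddMonoidHom.mulLeft u)).FiniteIndex := finiteIndex_comap _ _

lemma exists_ne_zero_mem [Infinite R] (W : AddSubgroup R) [hW : W.FiniteIndex] :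
    ∃ w ∈ W, w ≠ 0 := by
  by_contra! h
  have h0 : W = ⊥ := (AddSubgroup.eq_bot_iff_forall W).2 h
  have := hW.index_ne_zero
  rw [h0, AddSubgroup.index_bot, Nat.card_eq_zero_of_infinite] at this
  exact this rfl

/-- The additive endomorphism of multiplication by an element. -/
def mulEnd (x : R) : AddMonoid.End R := AddMonoidHom.mulLeft x

lemma mulEnd_apply (x f : R) : mulEnd x f = x * f := rfl

lemma mulEnd_pow_apply (x : R) (k : ℕ) (f : R) : (mulEnd x ^ k) f = x ^ k * f := by
  induction k generalizing f with
  | zero => rw [pow_zero, pow_zero, one_mul]; rfl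
  | succ k ih =>
    rw [pow_succ, pow_succ, mul_assoc, ← mulEnd_apply x f, ← ih]
    rfl

lemma bracket_swap (e : ℕ) (u v : R) : bracket e v u = -bracket e u v := by
  simp [bracket]

lemma map_bracket {S : Type*} [CommRing S] (φ : R →+* S) (e : ℕ) (u v : R) :
    φ (bracket e u v) = bracket e (φ u) (φ v) := by
  simp [bracket]

variable [IsDomain R]

/-- If `α` respects the relations between commutators, then, on a subgroup of finite index, it
respects the relations between the monomials `f * g ^ e`. -/
theorem exists_monomial_relations (p n : ℕ) [Fact p.Prime] [CharP R p] (hp : p ^ n ≠ 1)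
    [Infinite R] (hR : FiniteQuotients R) (x : R) (hx : ∀ k, 1 ≤ k → x ^ (p ^ n) ^ k ≠ x)
    (Y : AddSubgroup R) [Y.FiniteIndex] (α : R →+ R) (hinj : ∀ f ∈ Y, α f = 0 → f = 0)
    (hrel : ∀ f g : Fin 4 → R, (∀ i, f i ∈ Y) → (∀ i, g i ∈ Y) →
      (∑ i, bracket (p ^ n) (f i) (g i) = 0 ↔ ∑ i, bracket (p ^ n) (α (f i)) (α (g i)) = 0)) :
    ∃ W : AddSubgroup R, W.FiniteIndex ∧ W ≤ Y ∧
      ∀ f₁ ∈ W, ∀ g₁ ∈ W, ∀ f₂ ∈ W, ∀ g₂ ∈ W,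
        (f₁ * g₁ ^ p ^ n = f₂ * g₂ ^ p ^ n ↔ α f₁ * α g₁ ^ p ^ n = α f₂ * α g₂ ^ p ^ n) := by
  set e := p ^ n with he
  have he0 : e ≠ 0 := pow_ne_zero _ (Fact.out : p.Prime).ne_zero
  let E := AlgebraicClosure (FractionRing R)
  let ι : R →+* E := algebraMap R E
  have hι : Function.Injective ι := by
    have h1 : Function.Injective (algebraMap R (FractionRing R)) := IsFractionRing.injective _ _
    have h2 : Function.Injective (algebraMap (FractionRing R) E) :=
      (algebraMap (FractionRing R) E).injective
    exact h2.comp h1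
  have : CharP E p := charP_of_injective_ringHom hι p
  let α' : R →+ E := (ι : R →+ E).comp α
  have hα' : ∀ f, α' f = ι (α f) := fun _ => rfl
  have hker : ¬ α'.ker.FiniteIndex := by
    intro h
    obtain ⟨w, ⟨hw1, hw2⟩, hw0⟩ := exists_ne_zero_mem (α'.ker ⊓ Y)
    refine hw0 (hinj w hw2 (hι ?_))
    rw [map_zero, ← hα']
    exact hw1
  let W₀ : AddSubgroup R := Y ⊓ (Y.comap (AddMonoidHom.mulLeft x) ⊓
    (Y.comap (AddMonoidHom.mulLeft (x ^ e)) ⊓ Y.comap (AddMonoidHom.mulLeft (x ^ (e + 1)))))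
  have hW₀ : W₀.FiniteIndex := by
    have h1 := finiteIndex_comap_mul x Y
    have h2 := finiteIndex_comap_mul (x ^ e) Y
    have h3 := finiteIndex_comap_mul (x ^ (e + 1)) Y
    infer_instance
  obtain ⟨θ, W', hW', hθ⟩ := exists_eigenvalue_germ (E := E) p n hp (mulEnd x) (by
    intro k hk
    have h1 : AddMonoidHom.range (mulEnd x ^ (p ^ n) ^ k - mulEnd x) =
        (AddMonoidHom.mulLeft (x ^ (p ^ n) ^ k - x)).range := by
      congr 1
      ext f
      rw [AddMonoidHom.coe_mulLeft, sub_mul, ← mulEnd_pow_apply]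
      rfl
    rw [h1]
    exact hR _ (sub_ne_zero.2 (hx k hk))) W₀ α' hker (by
    rintro f ⟨hf1, hf2, hf3, hf4⟩ g ⟨hg1, hg2, hg3, hg4⟩
    -- The universal four-term relation. Only sums of brackets are allowed, so negative terms have
    -- their arguments swapped.
    have := (hrel ![x * f, g, x ^ (e + 1) * g, x ^ e * f] ![x * g, x ^ (e + 1) * f, f, x ^ e * g]
      (by intro i; fin_cases i <;> assumption) (by intro i; fin_cases i <;> assumption)).1 (by
        simp [Fin.sum_univ_four, bracket]; ring)
    simp only [Fin.sum_univ_four, Matrix.cons_val] at this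
    rw [bracket_swap _ (α (x ^ (e + 1) * f)), bracket_swap _ (α f)] at this
    simp only [mulEnd_pow_apply, mulEnd_apply, hα', ← map_bracket, ← map_sub, ← map_add]
    rw [← map_zero ι, ← this]
    congr 1
    ring)
  -- Powers of `x` up to `e ^ 2` are needed to compare `x ^ e ^ 2 - x` with `θ ^ e ^ 2 - θ`.
  let W : AddSubgroup R := W₀ ⊓ ⨅ i : Fin (e ^ 2), W'.comap (AddMonoidHom.mulLeft (x ^ (i : ℕ)))
  have hWfin : W.FiniteIndex := by
    have : (⨅ i : Fin (e ^ 2), W'.comap (AddMonoidHom.mulLeft (x ^ (i : ℕ)))).FiniteIndex :=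
      AddSubgroup.finiteIndex_iInf fun i => finiteIndex_comap_mul _ _
    infer_instance
  have hpow : ∀ f ∈ W, ∀ k ≤ e ^ 2, α' (x ^ k * f) = θ ^ k * α' f := by
    intro f hf k
    induction k with
    | zero => simp
    | succ k ih =>
      intro hk
      have h1 : x ^ k * f ∈ W' := (AddSubgroup.mem_iInf.1 hf.2) ⟨k, by omega⟩
      have h2 := hθ _ h1
      rw [mulEnd_apply, ih (by omega), ← mul_assoc, ← pow_succ', ← mul_assoc, ← pow_succ'] at h2
      exact h2
  have hee : e ≤ e ^ 2 := Nat.le_self_pow two_ne_zero e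
  -- Otherwise `α` would vanish on `(x ^ e ^ 2 - x) * W`, which has finite index.
  have hD' : θ ^ e ^ 2 - θ ≠ 0 := by
    intro h
    apply hker
    have hfin : (AddMonoidHom.mulLeft (x ^ e ^ 2 - x)).range.FiniteIndex :=
      hR _ (sub_ne_zero.2 (hx 2 (by norm_num)))
    have h1 : W.map (AddMonoidHom.mulLeft (x ^ e ^ 2 - x)) ≤ α'.ker := by
      rintro _ ⟨f, hf, rfl⟩
      have h2 := hpow f hf _ le_rfl
      have h3 := hpow f hf 1 (Nat.one_le_iff_ne_zero.2 (pow_ne_zero _ he0))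
      rw [AddMonoidHom.mem_ker, AddMonoidHom.coe_mulLeft, sub_mul, map_sub, h2]
      rw [pow_one, pow_one] at h3
      rw [h3, ← sub_mul, h, zero_mul]
    have h4 : (W.map (AddMonoidHom.mulLeft (x ^ e ^ 2 - x))).FiniteIndex := by
      have : (W.map (AddMonoidHom.mulLeft (x ^ e ^ 2 - x))).relIndex
          (AddMonoidHom.mulLeft (x ^ e ^ 2 - x)).range ≠ 0 := by
        rw [AddMonoidHom.range_eq_map, ← AddSubgroup.relIndex_comap, AddSubgroup.relIndex_top_right]
        exact (AddSubgroup.finiteIndex_of_le (AddSubgroup.le_comap_map _ W)).index_ne_zero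
      exact finiteIndex_of_relIndex this
    exact AddSubgroup.finiteIndex_of_le h1
  have hD : x ^ e ^ 2 - x ≠ 0 := sub_ne_zero.2 (hx 2 (by norm_num))
  refine ⟨W, hWfin, fun f hf => hf.1.1, ?_⟩
  intro f₁ hf₁ g₁ hg₁ f₂ hf₂ g₂ hg₂
  -- Two brackets produce `(x ^ e ^ 2 - x) * f₁ * g₁ ^ e`; the other two, with arguments swapped,
  -- subtract the same expression for `f₂` and `g₂`.
  have := hrel ![x * f₁, x ^ e * g₁, g₂, f₂] ![g₁, f₁, x * f₂, x ^ e * g₂]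
    (by
      intro i
      fin_cases i
      exacts [hf₁.1.2.1, hg₁.1.2.2.1, hg₂.1.1, hf₂.1.1])
    (by
      intro i
      fin_cases i
      exacts [hg₁.1.1, hf₁.1.1, hf₂.1.2.1, hg₂.1.2.2.1])
  have e1 : ∑ i, bracket e ((![x * f₁, x ^ e * g₁, g₂, f₂] : Fin 4 → R) i)
      ((![g₁, f₁, x * f₂, x ^ e * g₂] : Fin 4 → R) i) =
      (x ^ e ^ 2 - x) * (f₁ * g₁ ^ e - f₂ * g₂ ^ e) := by
    simp only [Fin.sum_univ_four, Matrix.cons_val, bracket, mul_pow, ← pow_mul, ← pow_two]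
    ring
  have e2 : ι (∑ i, bracket e (α ((![x * f₁, x ^ e * g₁, g₂, f₂] : Fin 4 → R) i))
      (α ((![g₁, f₁, x * f₂, x ^ e * g₂] : Fin 4 → R) i))) =
      (θ ^ e ^ 2 - θ) * (α' f₁ * α' g₁ ^ e - α' f₂ * α' g₂ ^ e) := by
    have hx1 : ∀ f ∈ W, α' (x * f) = θ * α' f := by
      intro f hf
      simpa using hpow f hf 1 (Nat.one_le_iff_ne_zero.2 (pow_ne_zero _ he0))
    simp only [Fin.sum_univ_four, Matrix.cons_val, map_add, map_bracket, ← hα']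
    rw [hx1 _ hf₁, hx1 _ hf₂, hpow _ hg₁ _ hee, hpow _ hg₂ _ hee]
    simp only [bracket, mul_pow, ← pow_mul, ← pow_two]
    ring
  replace this := this.trans (map_eq_zero_iff ι hι).symm
  rw [e1, e2, mul_eq_zero_iff_left hD, mul_eq_zero_iff_left hD',
    sub_eq_zero, sub_eq_zero] at this
  rw [this, hα', hα', hα', hα', ← map_pow ι, ← map_pow ι, ← map_mul ι, ← map_mul ι, hι.eq_iff]

/-- Additive maps respecting the relations between the monomials `f * g ^ e` respect ratios. -/
lemma cross_relation {p n : ℕ} [Fact p.Prime] [CharP R p] [Infinite R]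
    {V : AddSubgroup R} [V.FiniteIndex] {α : V →+ R} (hinj : Function.Injective α)
    (hα : ∀ f₁ g₁ f₂ g₂ : V, (f₁ * g₁ ^ p ^ n : R) = f₂ * g₂ ^ p ^ n →
      α f₁ * α g₁ ^ p ^ n = α f₂ * α g₂ ^ p ^ n)
    (f₁ g₁ f₂ g₂ : V) (h : (f₁ * g₂ : R) = f₂ * g₁) : α f₁ * α g₂ = α f₂ * α g₁ := by
  have hα0 : ∀ f : V, α f = 0 ↔ f = 0 := fun f => by
    rw [← map_zero α, hinj.eq_iff]
  by_cases hf₁ : f₁ = 0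
  · subst hf₁
    rcases mul_eq_zero.1 (show (f₂ * g₁ : R) = 0 by rw [← h]; simp) with h1 | h1
    · rw [(hα0 f₂).2 (Subtype.ext h1), map_zero, zero_mul, zero_mul]
    · rw [(hα0 g₁).2 (Subtype.ext h1), map_zero, zero_mul, mul_zero]
  have h1 := finiteIndex_comap_mul ((g₁ : R) ^ p ^ n) V
  have h2 := finiteIndex_comap_mul ((f₁ : R) ^ p ^ n) V
  -- Both `w * f₁ ^ e` and `w * g₁ ^ e` lie in `V`. Their values under `α` serve as a common
  -- quotient for the `e`-th powers of both ratios, and Frobenius is injective.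
  obtain ⟨w, ⟨hw1, hw2⟩, hw0⟩ := exists_ne_zero_mem
    (V.comap (AddMonoidHom.mulLeft ((g₁ : R) ^ p ^ n)) ⊓
      V.comap (AddMonoidHom.mulLeft ((f₁ : R) ^ p ^ n)))
  have e1 := hα ⟨_, hw2⟩ g₁ ⟨_, hw1⟩ f₁ (by simp only [AddMonoidHom.coe_mulLeft]; ring)
  have e2 := hα ⟨_, hw2⟩ g₂ ⟨_, hw1⟩ f₂ (by
    simp only [AddMonoidHom.coe_mulLeft]
    rw [mul_right_comm, ← mul_pow, h, mul_pow]
    ring)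
  have h0 : α ⟨_, hw2⟩ ≠ 0 := by
    rw [Ne, hα0]
    intro h
    have := congrArg Subtype.val h
    simp only [AddMonoidHom.coe_mulLeft, ZeroMemClass.coe_zero, mul_eq_zero, hw0, or_false] at this
    exact hf₁ (Subtype.ext (eq_zero_of_pow_eq_zero this))
  apply iterateFrobenius_inj R p n
  rw [iterateFrobenius_def, iterateFrobenius_def, mul_pow, mul_pow]
  apply mul_left_cancel₀ h0
  linear_combination (α f₁ ^ p ^ n) * e2 - (α f₂ ^ p ^ n) * e1

/-- An additive map that respects ratios is semilinear over a ring endomorphism. -/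
lemma exists_ringHom_of_cross [Infinite R] [IsNoetherianRing R] [IsIntegrallyClosed R]
    {V : AddSubgroup R} [V.FiniteIndex] {α : V →+ R} (hinj : Function.Injective α)
    (hα : ∀ f₁ g₁ f₂ g₂ : V, (f₁ * g₂ : R) = f₂ * g₁ → α f₁ * α g₂ = α f₂ * α g₁) :
    ∃ σ : R →+* R, ∀ (u : R) (g h : V), (h : R) = u * g → α h = σ u * α g := by
  have hα0 : ∀ f : V, f ≠ 0 → α f ≠ 0 := fun f hf h => hf (hinj (by rw [h, map_zero]))
  let L := FractionRing R
  let ι : R →+* L := algebraMap R L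
  have hι : Function.Injective ι := IsFractionRing.injective _ _
  have hsel : ∀ u : R, ∃ g h : V, g ≠ 0 ∧ (h : R) = u * g := by
    intro u
    have h1 := finiteIndex_comap_mul u V
    obtain ⟨w, ⟨hw1, hw2⟩, hw0⟩ := exists_ne_zero_mem (V ⊓ V.comap (AddMonoidHom.mulLeft u))
    exact ⟨⟨w, hw1⟩, ⟨_, hw2⟩, fun h => hw0 (congrArg Subtype.val h), rfl⟩
  choose G H hG hGH using hsel
  -- By `hα` the ratio `α (u * g) / α g` does not depend on `g`.
  let s : R → L := fun u => ι (α (H u)) / ι (α (G u))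
  have hs : ∀ (u : R) (g h : V), (h : R) = u * g → ι (α h) = s u * ι (α g) := by
    intro u g h hgh
    have h0 : ι (α (G u)) ≠ 0 := (map_ne_zero_iff ι hι).2 (hα0 _ (hG u))
    have := hα (H u) (G u) h g (by rw [hgh, hGH]; ring)
    simp only [s]
    rw [div_mul_eq_mul_div, eq_div_iff h0, ← map_mul ι, ← map_mul ι, this]
  have huniq : ∀ (u : R) (g h : V) (c : L), g ≠ 0 → (h : R) = u * g → ι (α h) = c * ι (α g) →
      s u = c := by
    intro u g h c hg hgh hc
    have h0 : ι (α g) ≠ 0 := (map_ne_zero_iff ι hι).2 (hα0 _ hg)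
    apply mul_right_cancel₀ h0
    rw [← hc, ← hs u g h hgh]
  let S : R →+* L :=
    { toFun := s
      map_one' := huniq 1 (G 1) (G 1) 1 (hG 1) (by rw [one_mul]) (by rw [one_mul])
      map_zero' := huniq 0 (G 1) 0 0 (hG 1) (by simp) (by simp)
      map_add' := by
        intro u v
        have h1 := finiteIndex_comap_mul u V
        have h2 := finiteIndex_comap_mul v V
        obtain ⟨w, ⟨⟨hw1, hw2⟩, hw3⟩, hw0⟩ := exists_ne_zero_mem
          (V ⊓ V.comap (AddMonoidHom.mulLeft u) ⊓ V.comap (AddMonoidHom.mulLeft v))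
        have e1 := hs u ⟨w, hw1⟩ ⟨_, hw2⟩ rfl
        have e2 := hs v ⟨w, hw1⟩ ⟨_, hw3⟩ rfl
        refine huniq _ ⟨w, hw1⟩ (⟨_, hw2⟩ + ⟨_, hw3⟩) _ (fun h => hw0 (congrArg Subtype.val h))
          (by simp [add_mul]) ?_
        rw [map_add, map_add, e1, e2, add_mul]
      map_mul' := by
        intro u v
        have h1 := finiteIndex_comap_mul v V
        have h2 := finiteIndex_comap_mul (u * v) V
        obtain ⟨w, ⟨⟨hw1, hw2⟩, hw3⟩, hw0⟩ := exists_ne_zero_mem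
          (V ⊓ V.comap (AddMonoidHom.mulLeft v) ⊓ V.comap (AddMonoidHom.mulLeft (u * v)))
        have e1 := hs v ⟨w, hw1⟩ ⟨_, hw2⟩ rfl
        have e2 := hs u ⟨_, hw2⟩ ⟨_, hw3⟩ (by simp [mul_assoc])
        refine huniq _ ⟨w, hw1⟩ ⟨_, hw3⟩ _ (fun h => hw0 (congrArg Subtype.val h)) rfl ?_
        rw [e2, e1, mul_assoc] }
  have hS : ∀ u, S u = s u := fun _ => rfl
  -- `α` is a multiple of `s` on `V`
  obtain ⟨g₀, hg₀, hg₀0⟩ := exists_ne_zero_mem V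
  have hmul : ∀ f : V, ι (α f) * s g₀ = ι (α ⟨g₀, hg₀⟩) * s f := by
    intro f
    have h1 := finiteIndex_comap_mul g₀ V
    have h2 := finiteIndex_comap_mul (f : R) V
    obtain ⟨w, ⟨⟨hw1, hw2⟩, hw3⟩, hw0⟩ := exists_ne_zero_mem
      (V ⊓ V.comap (AddMonoidHom.mulLeft g₀) ⊓ V.comap (AddMonoidHom.mulLeft (f : R)))
    have e1 := hs g₀ ⟨w, hw1⟩ ⟨_, hw2⟩ rfl
    have e2 := hs f ⟨w, hw1⟩ ⟨_, hw3⟩ rfl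
    have e3 := hα f ⟨_, hw3⟩ ⟨g₀, hg₀⟩ ⟨_, hw2⟩ (by simp only [AddMonoidHom.coe_mulLeft]; ring)
    have h0 : ι (α ⟨w, hw1⟩) ≠ 0 :=
      (map_ne_zero_iff ι hι).2 (hα0 _ (fun h => hw0 (congrArg Subtype.val h)))
    apply mul_right_cancel₀ h0
    rw [mul_assoc, mul_assoc, ← e1, ← e2, ← map_mul ι, ← map_mul ι, e3]
  -- On `V`, `s` is a fixed fraction times values of `α` in `R`, and `V` has finitely many cosets.
  -- So all powers of `s u` share a denominator, and `s u` is almost integral.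
  have hint : ∀ u, IsIntegral R (s u) := by
    intro u
    apply IsAlmostIntegral.isIntegral
    have : Finite (R ⧸ V) := AddSubgroup.finite_quotient_of_finiteIndex
    have := Fintype.ofFinite (R ⧸ V)
    obtain ⟨b, hb⟩ := IsLocalization.exist_integer_multiples_of_finite (nonZeroDivisors R)
      (fun q : Option (R ⧸ V) => q.elim (s g₀ / ι (α ⟨g₀, hg₀⟩)) fun q => s q.out)
    refine ⟨b, b.2, fun k => ?_⟩
    rw [← hS, ← map_pow, hS]
    obtain ⟨v, hv⟩ := QuotientAddGroup.mk_out_eq_add V (u ^ k)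
    have h1 : s (u ^ k) = s (QuotientAddGroup.mk (s := V) (u ^ k)).out - s v := by
      rw [hv, ← hS, ← hS, ← hS, map_add, add_sub_cancel_right]
    have h0 : ι (α ⟨g₀, hg₀⟩) ≠ 0 :=
      (map_ne_zero_iff ι hι).2 (hα0 _ (fun h => hg₀0 (congrArg Subtype.val h)))
    have h2 : s v = s g₀ / ι (α ⟨g₀, hg₀⟩) * ι (α v) := by
      rw [div_mul_eq_mul_div, eq_div_iff h0, mul_comm, ← hmul, mul_comm]
    rw [h1, h2, smul_sub]
    refine sub_mem (hb (some _)) ?_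
    rw [← smul_mul_assoc]
    exact mul_mem (hb none) ⟨_, rfl⟩
  have hlift : ∀ u, ∃ r, ι r = s u := fun u => IsIntegrallyClosed.isIntegral_iff.1 (hint u)
  choose σ hσ using hlift
  refine ⟨⟨⟨⟨σ, ?_⟩, ?_⟩, ?_, ?_⟩, ?_⟩
  · apply hι; rw [hσ, map_one, ← hS, map_one]
  · intro u v; apply hι; simp only [map_mul, hσ, ← hS]
  · apply hι; simp only [map_zero, hσ, ← hS]
  · intro u v; apply hι; simp only [map_add, hσ, ← hS]
  · intro u g h hgh
    apply hι
    simp only [map_mul, RingHom.coe_mk, MonoidHom.coe_mk, OneHom.coe_mk, hσ]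
    exact hs u g h hgh

/-- An additive bijection between subgroups of finite index that respects the relations between
the monomials `f * g ^ e` is a multiple of a ring automorphism. -/
theorem exists_ringEquiv_of_monomial_relations {p n : ℕ} [Fact p.Prime] [CharP R p] [Infinite R]
    [IsNoetherianRing R] [IsIntegrallyClosed R]
    {V W : AddSubgroup R} [V.FiniteIndex] [W.FiniteIndex] (α : V ≃+ W)
    (hα : ∀ f₁ g₁ f₂ g₂ : V, (f₁ * g₁ ^ p ^ n : R) = f₂ * g₂ ^ p ^ n ↔
      (α f₁ * α g₁ ^ p ^ n : R) = α f₂ * α g₂ ^ p ^ n) :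
    ∃ (σ : R ≃+* R) (a b : R), a ≠ 0 ∧ b ≠ 0 ∧ ∀ f : V, b * α f = a * σ f := by
  have hi1 : Function.Injective (W.subtype.comp (α : V →+ W)) :=
    Subtype.val_injective.comp α.injective
  have hi2 : Function.Injective (V.subtype.comp (α.symm : W →+ V)) :=
    Subtype.val_injective.comp α.symm.injective
  have hc1 := cross_relation (p := p) (n := n) hi1 (fun f₁ g₁ f₂ g₂ h => (hα _ _ _ _).1 h)
  have hc2 := cross_relation (p := p) (n := n) hi2 (fun f₁ g₁ f₂ g₂ h => (hα _ _ _ _).2 (by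
    simpa using h))
  obtain ⟨σ, hσ⟩ := exists_ringHom_of_cross hi1 hc1
  obtain ⟨τ, hτ⟩ := exists_ringHom_of_cross hi2 hc2
  simp only [AddMonoidHom.comp_apply, AddSubgroup.subtype_apply, AddMonoidHom.coe_coe] at hc1 hσ hτ
  have h1 : ∀ u, τ (σ u) = u := by
    intro u
    have h1 := finiteIndex_comap_mul u V
    obtain ⟨w, ⟨hw1, hw2⟩, hw0⟩ := exists_ne_zero_mem (V ⊓ V.comap (AddMonoidHom.mulLeft u))
    have e1 := hτ (σ u) _ _ (hσ u ⟨w, hw1⟩ ⟨_, hw2⟩ rfl)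
    simp only [AddEquiv.symm_apply_apply, AddMonoidHom.coe_mulLeft] at e1
    exact (mul_right_cancel₀ hw0 e1).symm
  have h2 : ∀ u, σ (τ u) = u := by
    intro u
    have h1 := finiteIndex_comap_mul u W
    obtain ⟨w, ⟨hw1, hw2⟩, hw0⟩ := exists_ne_zero_mem (W ⊓ W.comap (AddMonoidHom.mulLeft u))
    have e1 := hσ (τ u) _ _ (hτ u ⟨w, hw1⟩ ⟨_, hw2⟩ rfl)
    simp only [AddEquiv.apply_symm_apply, AddMonoidHom.coe_mulLeft] at e1
    exact (mul_right_cancel₀ hw0 e1).symm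
  obtain ⟨g₀, hg₀, hg₀0⟩ := exists_ne_zero_mem V
  have hα0 : ∀ f : V, f ≠ 0 → (α f : R) ≠ 0 := fun f hf h =>
    hf (α.injective (Subtype.ext (by rw [h, map_zero]; rfl)))
  refine ⟨RingEquiv.ofRingHom σ τ (RingHom.ext h2) (RingHom.ext h1), α ⟨g₀, hg₀⟩, σ g₀,
    hα0 _ fun h => hg₀0 (congrArg Subtype.val h), ?_, fun f => ?_⟩
  · intro h
    apply hg₀0
    rw [← h1 g₀, h, map_zero]
  · rw [RingEquiv.ofRingHom_apply]
    have h1 := finiteIndex_comap_mul g₀ V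
    have h2 := finiteIndex_comap_mul (f : R) V
    obtain ⟨w, ⟨⟨hw1, hw2⟩, hw3⟩, hw0⟩ := exists_ne_zero_mem
      (V ⊓ V.comap (AddMonoidHom.mulLeft g₀) ⊓ V.comap (AddMonoidHom.mulLeft (f : R)))
    have e1 := hσ g₀ ⟨w, hw1⟩ ⟨_, hw2⟩ rfl
    have e2 := hσ f ⟨w, hw1⟩ ⟨_, hw3⟩ rfl
    have e3 := hc1 f ⟨_, hw3⟩ ⟨g₀, hg₀⟩ ⟨_, hw2⟩ (by simp only [AddMonoidHom.coe_mulLeft]; ring)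
    apply mul_right_cancel₀ (hα0 ⟨w, hw1⟩ fun h => hw0 (congrArg Subtype.val h))
    rw [e1, e2] at e3
    linear_combination e3

end RingAut

/-! ### `K[t⁻¹]` inside `K((t))` -/

section Laurent

open Polynomial WithZero

variable (K : Type*) [Field K]

/-- The embedding of the polynomial ring onto `K[t⁻¹]`. -/
def invX : K[X] →ₐ[K] K⸨X⸩ := aeval (HahnSeries.single (-1 : ℤ) (1 : K))

lemma mem_Fminus_iff {s : K⸨X⸩} : s ∈ Fminus K ↔ ∃ f, invX K f = s := by
  rw [Fminus, Algebra.adjoin_singleton_eq_range_aeval]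
  rfl

variable {K}

lemma invX_monomial (k : ℕ) (c : K) : invX K (monomial k c) = HahnSeries.single (-k : ℤ) c := by
  rw [invX, aeval_monomial, HahnSeries.single_pow, one_pow, LaurentSeries.algebraMap_apply,
    HahnSeries.C_apply, HahnSeries.single_mul_single]
  simp

lemma coeff_invX (f : K[X]) (k : ℤ) :
    (invX K f).coeff k = if k ≤ 0 then f.coeff k.natAbs else 0 := by
  induction f using Polynomial.induction_on' with
  | add f g hf hg => rw [map_add, HahnSeries.coeff_add, hf, hg, coeff_add]; split_ifs <;> simp
  | monomial m c =>
    rw [invX_monomial, HahnSeries.coeff_single, coeff_monomial]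
    by_cases hk : k ≤ 0
    · rw [if_pos hk]
      congr 1
      rw [eq_iff_iff]
      omega
    · rw [if_neg hk, if_neg (by omega)]

lemma valuation_invX {f : K[X]} (hf : f ≠ 0) : Valued.v (invX K f) = exp (f.natDegree : ℤ) := by
  apply le_antisymm
  · have := (LaurentSeries.valuation_le_iff_coeff_lt_eq_zero K (D := -f.natDegree)
      (f := invX K f)).2 (by
        intro k hk
        rw [coeff_invX, if_pos (by omega)]
        exact coeff_eq_zero_of_natDegree_lt (by omega))
    simpa using this
  · by_contra! h
    have h1 : Valued.v (invX K f) ≤ exp (-(1 - f.natDegree : ℤ)) := by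
      rw [neg_sub]
      by_cases h0 : Valued.v (invX K f) = 0
      · rw [h0]; exact zero_le
      · rw [← log_le_iff_le_exp h0]
        rw [← log_lt_iff_lt_exp h0] at h
        omega
    have := (LaurentSeries.valuation_le_iff_coeff_lt_eq_zero K).1 h1 (-f.natDegree) (by omega)
    rw [coeff_invX, if_pos (by omega)] at this
    simp only [Int.natAbs_neg, Int.natAbs_natCast, coeff_natDegree, leadingCoeff_eq_zero] at this
    exact hf this

lemma invX_injective : Function.Injective (invX K) := by
  rw [injective_iff_map_eq_zero]
  intro f hf
  by_contra h
  have := valuation_invX h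
  rw [hf, map_zero] at this
  exact exp_ne_zero this.symm

/-- Nonzero constants are the units, so an automorphism acts on coefficients and substitutes the
image of `X`. Degrees are multiplied by that of the image, which invertibility forces to be one. -/
lemma natDegree_ringEquiv (σ : K[X] ≃+* K[X]) (f : K[X]) :
    (σ f).natDegree = f.natDegree := by
  have hC : ∀ (τ : K[X] ≃+* K[X]) (c : K), ∃ d, τ (C c) = C d := by
    intro τ c
    by_cases hc : c = 0
    · exact ⟨0, by simp [hc]⟩
    · have : IsUnit (τ (C c)) := (isUnit_C.2 (IsUnit.mk0 c hc)).map τ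
      exact ⟨_, eq_C_of_degree_eq_zero (isUnit_iff_degree_eq_zero.1 this)⟩
  have key : ∀ (τ : K[X] ≃+* K[X]) (f : K[X]), (τ f).natDegree = f.natDegree * (τ X).natDegree := by
    intro τ f
    choose g hg using hC τ
    have hg0 : ∀ c, g c = 0 → c = 0 := by
      intro c hc
      have := hg c
      rw [hc, C_0, map_eq_zero_iff τ τ.injective] at this
      exact C_eq_zero.1 this
    let γ : K →+* K := ((constantCoeff : K[X] →+* K).comp (τ : K[X] →+* K[X])).comp C
    have hγ : ∀ c, τ (C c) = C (γ c) := by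
      intro c
      have : γ c = constantCoeff (τ (C c)) := rfl
      rw [this, hg, constantCoeff_apply, coeff_C_zero]
    have : τ f = (f.map γ).comp (τ X) := by
      induction f using Polynomial.induction_on' with
      | add f h hf hh => simp [hf, hh]
      | monomial k c => rw [← C_mul_X_pow_eq_monomial]; simp [hγ]
    rw [this, natDegree_comp, natDegree_map]
  have h1 := key σ (σ.symm X)
  rw [RingEquiv.apply_symm_apply, natDegree_X] at h1
  have h2 : (σ X).natDegree = 1 := Nat.eq_one_of_mul_eq_one_left h1.symm
  rw [key, h2, mul_one]

/-- The embedding of the fraction field of `K[t⁻¹]`. -/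
def fracEmb : FractionRing K[X] →+* K⸨X⸩ :=
  IsFractionRing.lift (g := (invX K : K[X] →+* K⸨X⸩)) invX_injective

lemma fracEmb_algebraMap (f : K[X]) : fracEmb (algebraMap _ _ f) = invX K f :=
  IsFractionRing.lift_algebraMap _ _

-- The image is a field containing the constants and `t`, the inverse of `t⁻¹`, hence all rational
-- functions in `t`.
attribute [local instance] RatFunc.liftAlgebra in
lemma denseRange_fracEmb : DenseRange (fracEmb (K := K)) := by
  refine (LaurentSeries.coe_range_dense (K := K)).mono ?_
  rintro _ ⟨r, rfl⟩
  change _ ∈ (fracEmb (K := K)).fieldRange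
  have hC : ∀ c : K, algebraMap K K⸨X⸩ c ∈ (fracEmb (K := K)).fieldRange := by
    intro c
    refine ⟨algebraMap _ _ (C c), ?_⟩
    rw [fracEmb_algebraMap, ← algebraMap_eq, AlgHom.commutes]
  have hX : (HahnSeries.single (1 : ℤ) (1 : K) : K⸨X⸩) ∈ (fracEmb (K := K)).fieldRange := by
    have h1 : (invX K X) ∈ (fracEmb (K := K)).fieldRange := ⟨_, fracEmb_algebraMap X⟩
    have h2 := inv_mem h1
    rwa [invX, aeval_X, HahnSeries.inv_single, neg_neg, inv_one] at h2
  have hP : ∀ P : K[X], algebraMap K[X] K⸨X⸩ P ∈ (fracEmb (K := K)).fieldRange := by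
    intro P
    induction P using Polynomial.induction_on' with
    | add f g hf hg => rw [map_add]; exact add_mem hf hg
    | monomial k c =>
      rw [← C_mul_X_pow_eq_monomial, map_mul, map_pow, HahnSeries.algebraMap_apply',
        HahnSeries.algebraMap_apply', ← Polynomial.algebraMap_eq]
      have h1 := hC c
      rw [LaurentSeries.algebraMap_apply] at h1
      refine mul_mem ?_ (pow_mem ?_ _)
      · rwa [PowerSeries.algebraMap_apply', Algebra.algebraMap_self, PowerSeries.map_id, id_eq, algebraMap_eq,
          Polynomial.coe_C, HahnSeries.ofPowerSeries_C]
      · rwa [PowerSeries.algebraMap_apply', Algebra.algebraMap_self, PowerSeries.map_id, id_eq,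
          Polynomial.coe_X, HahnSeries.ofPowerSeries_X]
  rw [← RatFunc.num_div_denom r, RatFunc.algebraMap_apply_div]
  exact div_mem (hP _) (hP _)

lemma valuation_fracEmb (σ : K[X] ≃+* K[X]) (u : FractionRing K[X]) :
    Valued.v (fracEmb (IsFractionRing.ringEquivOfRingEquiv (K := FractionRing K[X])
      (L := FractionRing K[X]) σ u)) = Valued.v (fracEmb u) := by
  obtain ⟨a, b, hb, rfl⟩ := IsFractionRing.div_surjective (A := K[X]) u
  have hv : ∀ f : K[X], Valued.v (invX K (σ f)) = Valued.v (invX K f) := by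
    intro f
    by_cases hf : f = 0
    · simp [hf]
    · rw [valuation_invX hf, valuation_invX ((map_ne_zero_iff σ σ.injective).2 hf),
        natDegree_ringEquiv]
  simp only [map_div₀, IsFractionRing.ringEquivOfRingEquiv_algebraMap, fracEmb_algebraMap, hv]

/-- By `valuation_fracEmb`, `σ` is isometric on the dense fraction field, so it extends by uniform
continuity. -/
lemma exists_continuous_ringHom (σ : K[X] ≃+* K[X]) :
    ∃ S : K⸨X⸩ →+* K⸨X⸩, Continuous S ∧ ∀ f, S (invX K f) = invX K (σ f) := by
  let _ : UniformSpace (FractionRing K[X]) := UniformSpace.comap (fracEmb (K := K)) inferInstance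
  have hu : IsUniformInducing (fracEmb (K := K)) := ⟨rfl⟩
  let g : FractionRing K[X] →+* K⸨X⸩ := (fracEmb (K := K)).comp
    (IsFractionRing.ringEquivOfRingEquiv (K := FractionRing K[X])
      (L := FractionRing K[X]) σ : FractionRing K[X] →+* FractionRing K[X])
  have hg : UniformContinuous g := by
    have hb := Valued.hasBasis_uniformity K⸨X⸩ ℤᵐ⁰
    refine ((hb.comap _).tendsto_iff hb).2 fun γ _ => ⟨γ, trivial, ?_⟩
    rintro ⟨a, b⟩ hab
    simp only [Set.mem_preimage, Set.mem_ofPred_eq, Valuation.restrict_lt_iff_lt_embedding] at hab ⊢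
    rw [← map_sub] at hab ⊢
    simp only [g, RingHom.comp_apply, RingEquiv.coe_toRingHom]
    erw [valuation_fracEmb]
    exact hab
  refine ⟨IsDenseInducing.extendRingHom hu denseRange_fracEmb hg, ?_, fun f => ?_⟩
  · exact (uniformContinuous_uniformly_extend hu denseRange_fracEmb hg).continuous
  · have := IsDenseInducing.extend_eq (hu.isDenseInducing denseRange_fracEmb) hg.continuous
      (algebraMap _ _ f)
    rw [fracEmb_algebraMap] at this
    refine this.trans ?_
    simp [g, fracEmb_algebraMap]

lemma eq_id_of_continuous {S : K⸨X⸩ →+* K⸨X⸩} (hS : Continuous S)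
    (h : ∀ f, S (invX K f) = invX K f) (s : K⸨X⸩) : S s = s := by
  have : (S : K⸨X⸩ → K⸨X⸩) = id := by
    refine denseRange_fracEmb.equalizer hS continuous_id ?_
    ext1 u
    obtain ⟨a, b, hb, rfl⟩ := IsFractionRing.div_surjective (A := K[X]) u
    simp [fracEmb_algebraMap, h]
  exact congrFun this s

theorem exists_continuous_ringEquiv (σ : K[X] ≃+* K[X]) :
    ∃ S : K⸨X⸩ ≃+* K⸨X⸩, Continuous S ∧ Continuous S.symm ∧
      ∀ f, S (invX K f) = invX K (σ f) := by
  obtain ⟨S, hS, hS'⟩ := exists_continuous_ringHom σ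
  obtain ⟨T, hT, hT'⟩ := exists_continuous_ringHom σ.symm
  refine ⟨RingEquiv.ofRingHom S T (RingHom.ext ?_) (RingHom.ext ?_), hS, hT, hS'⟩
  · exact eq_id_of_continuous (S := S.comp T) (hS.comp hT) (by simp [hS', hT'])
  · exact eq_id_of_continuous (S := T.comp S) (hT.comp hS) (by simp [hS', hT'])

lemma finiteQuotients_polynomial [Finite K] : FiniteQuotients K[X] := by
  intro r hr
  have h1 : Module.Finite K (AdjoinRoot r) := (AdjoinRoot.powerBasis hr).finite
  have h2 : Finite (AdjoinRoot r) := Module.finite_of_finite K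
  have h3 : Finite (K[X] ⧸ (Ideal.span {r}).toAddSubgroup) := h2
  have h4 : (AddMonoidHom.mulLeft r).range = (Ideal.span {r}).toAddSubgroup := by
    ext f
    simp only [AddMonoidHom.mem_range, AddMonoidHom.coe_mulLeft, Submodule.mem_toAddSubgroup,
      Ideal.mem_span_singleton, dvd_iff_exists_eq_mul_right, eq_comm]
  rw [h4]
  exact AddSubgroup.finiteIndex_of_finite_quotient

end Laurent

/-! ### Coordinates on `G2` -/

section Coordinates

lemma neg_pow_char_pow {R : Type*} [CommRing R] {p n : ℕ} [Fact p.Prime] [CharP R p] (y : R) :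
    (-y) ^ p ^ n = -y ^ p ^ n := by
  have h := map_neg (iterateFrobenius R p n) y
  simpa [iterateFrobenius_def] using h

variable {F : Type*} [Field F] {p : ℕ} [Fact p.Prime] [CharP F p] {n : ℕ}

/-- The element of `G2` with given coordinates. -/
def mkG2 (p : ℕ) [Fact p.Prime] [CharP F p] (n : ℕ) (y z : F) : G2 F p n :=
  ⟨⟨!![1, y ^ p ^ n, z; 0, 1, y; 0, 0, 1], !![1, -y ^ p ^ n, y ^ p ^ n * y - z; 0, 1, -y; 0, 0, 1],
    by
      ext i j
      fin_cases i <;> fin_cases j <;> simp [Matrix.mul_apply, Fin.sum_univ_three]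
      ring,
    by
      ext i j
      fin_cases i <;> fin_cases j <;> simp [Matrix.mul_apply, Fin.sum_univ_three]
      ring⟩,
    y, z, rfl⟩

/-- The coordinate `y`. -/
def yG2 (g : G2 F p n) : F := (g : GL (Fin 3) F).1 1 2

/-- The coordinate `z`. -/
def zG2 (g : G2 F p n) : F := (g : GL (Fin 3) F).1 0 2

@[simp] lemma yG2_mk (y z : F) : yG2 (mkG2 p n y z) = y := rfl

@[simp] lemma zG2_mk (y z : F) : zG2 (mkG2 p n y z) = z := rfl

@[simp] lemma mk_yG2_zG2 (g : G2 F p n) : mkG2 p n (yG2 g) (zG2 g) = g := by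
  obtain ⟨g, y, z, h⟩ := g
  have hy : yG2 (⟨g, y, z, h⟩ : G2 F p n) = y := by simp [yG2, h]
  have hz : zG2 (⟨g, y, z, h⟩ : G2 F p n) = z := by simp [zG2, h]
  rw [hy, hz]
  exact Subtype.ext (Units.ext h.symm)

lemma G2_ext {g h : G2 F p n} (hy : yG2 g = yG2 h) (hz : zG2 g = zG2 h) : g = h := by
  rw [← mk_yG2_zG2 g, ← mk_yG2_zG2 h, hy, hz]

lemma mkG2_mul (y z y' z' : F) : mkG2 p n y z * mkG2 p n y' z' =
    mkG2 p n (y + y') (z + z' + y ^ p ^ n * y') := by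
  apply Subtype.ext
  apply Units.ext
  change !![1, y ^ p ^ n, z; 0, 1, y; 0, 0, 1] * !![1, y' ^ p ^ n, z'; 0, 1, y'; 0, 0, 1] =
    !![1, (y + y') ^ p ^ n, z + z' + y ^ p ^ n * y'; 0, 1, y + y'; 0, 0, 1]
  rw [add_pow_char_pow]
  ext i j
  fin_cases i <;> fin_cases j <;> simp [Matrix.mul_apply, Fin.sum_univ_three] <;> ring

lemma yG2_mul (g h : G2 F p n) : yG2 (g * h) = yG2 g + yG2 h := by
  rw [← mk_yG2_zG2 g, ← mk_yG2_zG2 h, mkG2_mul]; rfl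

lemma zG2_mul (g h : G2 F p n) : zG2 (g * h) = zG2 g + zG2 h + yG2 g ^ p ^ n * yG2 h := by
  rw [← mk_yG2_zG2 g, ← mk_yG2_zG2 h, mkG2_mul]; rfl

lemma mkG2_zero : mkG2 p n (0 : F) 0 = 1 := by
  have h := mkG2_mul (p := p) (n := n) (0 : F) 0 0 0
  simp only [add_zero, mul_zero] at h
  exact mul_eq_left.1 h

@[simp] lemma yG2_one : yG2 (1 : G2 F p n) = 0 := by rw [← mkG2_zero, yG2_mk]

@[simp] lemma zG2_one : zG2 (1 : G2 F p n) = 0 := by rw [← mkG2_zero, zG2_mk]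

/-- The coordinate `y`, as a homomorphism. -/
def yHom : G2 F p n →* Multiplicative F where
  toFun g := Multiplicative.ofAdd (yG2 g)
  map_one' := by rw [yG2_one]; rfl
  map_mul' g h := by rw [yG2_mul]; rfl

lemma yG2_inv (g : G2 F p n) : yG2 g⁻¹ = -yG2 g := map_inv yHom g

lemma zG2_inv (g : G2 F p n) : zG2 g⁻¹ = yG2 g ^ p ^ n * yG2 g - zG2 g := by
  have h := zG2_mul g g⁻¹
  rw [mul_inv_cancel, zG2_one, yG2_inv] at h
  linear_combination -h

variable [TopologicalSpace F]

lemma continuous_yG2 : Continuous (yG2 : G2 F p n → F) :=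
  (Units.continuous_val.comp continuous_subtype_val).matrix_elem 1 2

lemma continuous_zG2 : Continuous (zG2 : G2 F p n → F) :=
  (Units.continuous_val.comp continuous_subtype_val).matrix_elem 0 2

lemma continuous_mkG2 [IsTopologicalRing F] : Continuous fun q : F × F => mkG2 p n q.1 q.2 := by
  refine Continuous.subtype_mk (Units.continuous_iff.2 ⟨?_, ?_⟩) _
  · refine continuous_matrix fun i j => ?_
    fin_cases i <;> fin_cases j <;> simp <;> fun_prop
  · refine continuous_matrix fun i j => ?_
    fin_cases i <;> fin_cases j <;> simp <;> fun_prop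

/-- A continuous field automorphism `S`, a scalar `a` and a continuous additive map `κ`
define a continuous automorphism of `G2`. -/
theorem exists_continuousMulEquiv [IsTopologicalRing F] (S : F ≃+* F) (hS : Continuous S) (hS' : Continuous S.symm)
    {a : F} (ha : a ≠ 0) (κ : F →+ F) (hκ : Continuous κ) :
    ∃ Λ : G2 F p n ≃ₜ* G2 F p n, ∀ g,
      Λ g = mkG2 p n (a * S (yG2 g)) (a ^ (p ^ n + 1) * S (zG2 g) + κ (yG2 g)) := by
  have ha' : a ^ (p ^ n + 1) ≠ 0 := pow_ne_zero _ ha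
  refine ⟨
    { toFun := fun g => mkG2 p n (a * S (yG2 g)) (a ^ (p ^ n + 1) * S (zG2 g) + κ (yG2 g))
      invFun := fun g => mkG2 p n (S.symm (a⁻¹ * yG2 g))
        (S.symm ((a ^ (p ^ n + 1))⁻¹ * (zG2 g - κ (S.symm (a⁻¹ * yG2 g)))))
      left_inv := fun g => by
        apply G2_ext
        · simp [ha]
        · simp [ha]
      right_inv := fun g => by
        apply G2_ext
        · simp [ha]
        · simp [ha]
      map_mul' := fun g h => by
        rw [mkG2_mul]
        simp only [yG2_mul, zG2_mul, map_add, map_mul, map_pow]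
        congr 1 <;> ring
      continuous_toFun := by
        refine continuous_mkG2.comp (Continuous.prodMk ?_ ?_)
        · exact continuous_const.mul (hS.comp continuous_yG2)
        · exact (continuous_const.mul (hS.comp continuous_zG2)).add (hκ.comp continuous_yG2)
      continuous_invFun := by
        have h1 : Continuous fun g : G2 F p n => S.symm (a⁻¹ * yG2 g) :=
          hS'.comp (continuous_const.mul continuous_yG2)
        exact continuous_mkG2.comp (h1.prodMk (hS'.comp
          (continuous_const.mul (continuous_zG2.sub (hκ.comp h1))))) }, fun g => rfl⟩

/-- An automorphism of the topological group, as a virtual automorphism. -/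
def VirtualIso.ofEquiv {G : Type*} [Group G] [TopologicalSpace G] (Λ : G ≃ₜ* G) :
    VirtualAut G where
  dom := ⊤
  cod := ⊤
  dom_finiteIndex := inferInstance
  dom_isOpen := isOpen_univ
  cod_finiteIndex := inferInstance
  cod_isOpen := isOpen_univ
  iso :=
    { toFun := fun g => ⟨Λ g, trivial⟩
      invFun := fun g => ⟨Λ.symm g, trivial⟩
      left_inv := fun g => Subtype.ext (Λ.symm_apply_apply g)
      right_inv := fun g => Subtype.ext (Λ.apply_symm_apply g)
      map_mul' := fun g h => Subtype.ext (map_mul Λ (g : G) h)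
      continuous_toFun := (Λ.continuous.comp continuous_subtype_val).subtype_mk _
      continuous_invFun := (Λ.symm.continuous.comp continuous_subtype_val).subtype_mk _ }

end Coordinates

/-! ### The group of integral points -/

section Heis

/-- The group of pairs `(y, z)` with `(y, z) * (y', z') = (y + y', z + z' + y ^ (p ^ n) * y')`. -/
@[ext]
structure Heis (R : Type*) (p n : ℕ) where
  /-- the first coordinate -/
  y : R
  /-- the second coordinate -/
  z : R

variable {R : Type*} [CommRing R] {p n : ℕ}

instance : Mul (Heis R p n) := ⟨fun g h => ⟨g.y + h.y, g.z + h.z + g.y ^ p ^ n * h.y⟩⟩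
instance : One (Heis R p n) := ⟨⟨0, 0⟩⟩
instance : Inv (Heis R p n) := ⟨fun g => ⟨-g.y, g.y ^ p ^ n * g.y - g.z⟩⟩

@[simp] lemma Heis.mul_y (g h : Heis R p n) : (g * h).y = g.y + h.y := rfl
@[simp] lemma Heis.mul_z (g h : Heis R p n) : (g * h).z = g.z + h.z + g.y ^ p ^ n * h.y := rfl
@[simp] lemma Heis.one_y : (1 : Heis R p n).y = 0 := rfl
@[simp] lemma Heis.one_z : (1 : Heis R p n).z = 0 := rfl
@[simp] lemma Heis.inv_y (g : Heis R p n) : g⁻¹.y = -g.y := rfl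
@[simp] lemma Heis.inv_z (g : Heis R p n) : g⁻¹.z = g.y ^ p ^ n * g.y - g.z := rfl

lemma Heis.mul_mk_zero (u v : R) : (⟨0, u⟩ * ⟨0, v⟩ : Heis R p n) = ⟨0, u + v⟩ := by
  ext <;> simp

variable [Fact p.Prime] [CharP R p]

instance : Group (Heis R p n) := Group.ofLeftAxioms
  (fun a b c => by
    ext
    · simp [add_assoc]
    · simp only [Heis.mul_z, Heis.mul_y, add_pow_char_pow]; ring)
  (fun a => by
    ext
    · simp
    · simp [zero_pow (pow_ne_zero n (Fact.out : p.Prime).ne_zero)])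
  (fun a => by
    ext
    · simp
    · simp [neg_pow_char_pow])

namespace Heis

/-- The first coordinate as a homomorphism. -/
def yHom : Heis R p n →* Multiplicative R where
  toFun g := Multiplicative.ofAdd g.y
  map_one' := rfl
  map_mul' _ _ := rfl

/-- The first coordinates of the elements of a subgroup. -/
def yProj (Δ : Subgroup (Heis R p n)) : AddSubgroup R := Subgroup.toAddSubgroup' (Δ.map yHom)

lemma mem_yProj {Δ : Subgroup (Heis R p n)} {f : R} : f ∈ yProj Δ ↔ ∃ g ∈ Δ, g.y = f := Iff.rfl

lemma finiteIndex_yProj (Δ : Subgroup (Heis R p n)) [hΔ : Δ.FiniteIndex] :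
    (yProj Δ).FiniteIndex := by
  have h1 : (Δ.map yHom).index ≠ 0 := fun h => hΔ.index_ne_zero
    (Nat.eq_zero_of_zero_dvd (h ▸ Subgroup.index_map_dvd Δ fun f => ⟨⟨f.toAdd, 0⟩, rfl⟩))
  exact ⟨h1⟩

lemma commutator_eq (g h : Heis R p n) :
    g * h * g⁻¹ * h⁻¹ = ⟨0, bracket (p ^ n) g.y h.y⟩ := by
  ext
  · simp
  · simp only [mul_z, mul_y, inv_y, inv_z, bracket, add_pow_char_pow, neg_pow_char_pow]
    ring

lemma commute_iff (g h : Heis R p n) : g * h = h * g ↔ bracket (p ^ n) g.y h.y = 0 := by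
  rw [← mul_inv_eq_one, mul_inv_rev, ← mul_assoc, mul_assoc g h, mul_assoc g]
  constructor
  · intro hc
    have h1 := commutator_eq g h
    rw [show g * h * g⁻¹ * h⁻¹ = g * (h * g⁻¹ * h⁻¹) by group, hc] at h1
    simpa using (congrArg Heis.z h1).symm
  · intro hc
    rw [show g * (h * g⁻¹ * h⁻¹) = g * h * g⁻¹ * h⁻¹ by group, commutator_eq, hc]
    rfl

lemma map_commutator {Δ : Subgroup (Heis R p n)} (μ : Δ →* Heis R p n) (g h : Δ) :
    μ (g * h * g⁻¹ * h⁻¹) = ⟨0, bracket (p ^ n) (μ g).y (μ h).y⟩ := by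
  rw [map_mul, map_mul, map_mul, map_inv, map_inv, commutator_eq]

variable [IsDomain R] [Infinite R]

/-- An element that commutes with a subgroup of finite index is central. -/
lemma y_eq_zero_of_commute (hp : p ^ n ≠ 1) (Δ : Subgroup (Heis R p n)) [Δ.FiniteIndex]
    {g : Heis R p n} (hg : ∀ h ∈ Δ, g * h = h * g) : g.y = 0 := by
  by_contra h0
  have h1 : p ^ n ≠ 0 := pow_ne_zero _ (Fact.out : p.Prime).ne_zero
  -- Elements commuting with `g` have first coordinate a root of `q`. As `e ≠ 1`, the linear
  -- coefficient of `q` is `g.y ^ e`. So `yProj Δ` would be finite and of finite index in the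
  -- infinite ring `R`.
  let q : Polynomial R := Polynomial.C (g.y ^ p ^ n) * Polynomial.X -
    Polynomial.X ^ p ^ n * Polynomial.C g.y
  have hq : q ≠ 0 := by
    intro h
    have := congrArg (fun q => Polynomial.coeff q 1) h
    simp only [q, Polynomial.coeff_sub, Polynomial.coeff_C_mul, Polynomial.coeff_X_one,
      Polynomial.coeff_mul_C, Polynomial.coeff_X_pow, if_neg hp.symm, Polynomial.coeff_zero,
      mul_one, zero_mul, sub_zero] at this
    exact h0 (eq_zero_of_pow_eq_zero this)
  have hfin : ((yProj Δ : AddSubgroup R) : Set R).Finite := by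
    refine (Polynomial.finite_setOfPred_isRoot hq).subset ?_
    rintro _ ⟨h, hh, rfl⟩
    have := (commute_iff g h).1 (hg h hh)
    change q.IsRoot h.y
    simp only [bracket] at this
    simp only [q, Polynomial.IsRoot, Polynomial.eval_sub, Polynomial.eval_mul, Polynomial.eval_C,
      Polynomial.eval_X, Polynomial.eval_pow]
    exact this
  have h2 := finiteIndex_yProj Δ
  have : Finite (yProj Δ) := hfin
  have : Finite (R ⧸ yProj Δ) := AddSubgroup.finite_quotient_of_finiteIndex
  have h3 : Finite R := Finite.of_equiv _ (AddSubgroup.addGroupEquivQuotientProdAddSubgroup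
    (s := yProj Δ)).symm
  exact not_finite R

end Heis

/-- A homomorphism into an `𝔽_p`-vector space factors through an additive map if it vanishes on the
kernel. -/
lemma exists_addHom_factor (p : ℕ) [Fact p.Prime] {D A B : Type*} [Group D] [AddCommGroup A]
    [AddCommGroup B] [Module (ZMod p) A] [Module (ZMod p) B] (u : D →* Multiplicative A)
    (w : D →* Multiplicative B) (h : ∀ g, u g = 1 → w g = 1) :
    ∃ α : A →+ B, ∀ g, α (u g).toAdd = (w g).toAdd := by
  have h' : ∀ g g', u g = u g' → w g = w g' := by
    intro g g' hg
    have := h (g * g'⁻¹) (by rw [map_mul, map_inv, hg, mul_inv_cancel])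
    rwa [map_mul, map_inv, mul_inv_eq_one] at this
  let Y : AddSubgroup A := Subgroup.toAddSubgroup' u.range
  have hY : ∀ y : Y, ∃ g, u g = Multiplicative.ofAdd (y : A) := fun y => y.2
  choose s hs using hY
  let f : Y →+ B :=
    { toFun := fun y => (w (s y)).toAdd
      map_zero' := by
        have : w (s 0) = 1 := h _ (by rw [hs]; rfl)
        rw [this]; rfl
      map_add' := fun y y' => by
        have : w (s (y + y')) = w (s y * s y') := h' _ _ (by rw [map_mul, hs, hs, hs]; rfl)
        rw [this, map_mul]; rfl }
  -- Over a field every linear map on a subspace extends to the whole space.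
  let Y' : Submodule (ZMod p) A := AddSubgroup.toZModSubmodule p Y
  let f' : Y' →ₗ[ZMod p] B := AddMonoidHom.toZModLinearMap p (M := Y') (show Y' →+ B from f)
  obtain ⟨α, hα⟩ := LinearMap.exists_extend f'
  refine ⟨α.toAddMonoidHom, fun g => ?_⟩
  have h1 := LinearMap.congr_fun hα ⟨(u g).toAdd, ⟨g, rfl⟩⟩
  refine h1.trans ?_
  have : w (s ⟨(u g).toAdd, ⟨g, rfl⟩⟩) = w g := h' _ _ (hs _)
  exact congrArg Multiplicative.toAdd this

namespace Heis

variable [IsDomain R] [Infinite R] {Δ : Subgroup (Heis R p n)} {μ : Δ →* Heis R p n}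

/-- An element with `y = 0` is central, so its image commutes with the finite-index subgroup
`μ.range`. -/
lemma y_map_eq_zero (hp : p ^ n ≠ 1) [μ.range.FiniteIndex] {g : Δ} (hg : (g : Heis R p n).y = 0) :
    (μ g).y = 0 := by
  refine y_eq_zero_of_commute hp μ.range ?_
  rintro _ ⟨h, rfl⟩
  rw [← map_mul, ← map_mul]
  congr 1
  apply Subtype.ext
  change (g * h : Heis R p n) = h * g
  rw [commute_iff, hg]
  simp [bracket, zero_pow (pow_ne_zero n (Fact.out : p.Prime).ne_zero)]

lemma y_eq_zero_of_y_map [Δ.FiniteIndex] (hp : p ^ n ≠ 1) (hμ : Function.Injective μ) {g : Δ}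
    (hg : (μ g).y = 0) : (g : Heis R p n).y = 0 := by
  refine y_eq_zero_of_commute hp Δ fun h hh => ?_
  have : g * ⟨h, hh⟩ = ⟨h, hh⟩ * g := by
    apply hμ
    rw [map_mul, map_mul, commute_iff, hg]
    simp [bracket, zero_pow (pow_ne_zero n (Fact.out : p.Prime).ne_zero)]
  exact congrArg Subtype.val this

/-- The action on the first coordinates. -/
lemma exists_yMap (hp : p ^ n ≠ 1) (μ : Δ →* Heis R p n) [μ.range.FiniteIndex] :
    ∃ α : R →+ R, ∀ g : Δ, α (g : Heis R p n).y = (μ g).y := by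
  let _ : Module (ZMod p) R := (ZMod.algebra R p).toModule
  exact exists_addHom_factor p (yHom.comp Δ.subtype) (yHom.comp μ) fun g hg =>
    congrArg Multiplicative.ofAdd (y_map_eq_zero (g := g) hp (congrArg Multiplicative.toAdd hg))

/-- An isomorphism between subgroups of finite index is, on subgroups of finite index of the
first coordinates and of the center, given by a ring automorphism. -/
theorem exists_ringEquiv (hp : p ^ n ≠ 1) [IsNoetherianRing R] [IsIntegrallyClosed R]
    (hR : FiniteQuotients R) (x : R) (hx : ∀ k, 1 ≤ k → x ^ (p ^ n) ^ k ≠ x)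
    [Δ.FiniteIndex] [μ.range.FiniteIndex] (hμ : Function.Injective μ) :
    ∃ (σ : R ≃+* R) (a b : R) (V Z : AddSubgroup R), a ≠ 0 ∧ b ≠ 0 ∧ V.FiniteIndex ∧
      Z.FiniteIndex ∧ (∀ g : Δ, (g : Heis R p n).y ∈ V → b * (μ g).y = a * σ (g : Heis R p n).y) ∧
      ∀ g : Δ, (g : Heis R p n).y = 0 → (g : Heis R p n).z ∈ Z →
        b ^ (p ^ n + 1) * (μ g).z = a ^ (p ^ n + 1) * σ (g : Heis R p n).z := by
  obtain ⟨α, hα⟩ := exists_yMap hp μ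
  have hY := finiteIndex_yProj Δ
  have hY' := finiteIndex_yProj μ.range
  have hinj : ∀ f ∈ yProj Δ, α f = 0 → f = 0 := by
    rintro _ ⟨g, hg, rfl⟩ h
    refine y_eq_zero_of_y_map (g := ⟨g, hg⟩) hp hμ ?_
    rw [← hα]
    exact h
  obtain ⟨W, hW, hWY, hmon⟩ := exists_monomial_relations p n hp hR x hx (yProj Δ) α hinj (by
    intro f g hf hg
    choose F hF hFf using fun i => mem_yProj.1 (hf i)
    choose G hG hGg using fun i => mem_yProj.1 (hg i)
    let c : Fin 4 → Δ := fun i =>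
      ⟨F i, hF i⟩ * ⟨G i, hG i⟩ * (⟨F i, hF i⟩ : Δ)⁻¹ * (⟨G i, hG i⟩ : Δ)⁻¹
    have hc : ∀ i, (c i : Heis R p n) = ⟨0, bracket (p ^ n) (f i) (g i)⟩ := by
      intro i
      rw [← hFf, ← hGg, ← commutator_eq]
      rfl
    have hc' : ∀ i, μ (c i) = ⟨0, bracket (p ^ n) (α (f i)) (α (g i))⟩ := by
      intro i
      rw [map_commutator, ← hα, ← hα, hFf, hGg]
    have h1 : ((c 0 * c 1 * c 2 * c 3 : Δ) : Heis R p n) =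
        ⟨0, ∑ i, bracket (p ^ n) (f i) (g i)⟩ := by
      simp only [Subgroup.coe_mul, hc, mul_mk_zero, Fin.sum_univ_four]
    have h2 : μ (c 0 * c 1 * c 2 * c 3) =
        ⟨0, ∑ i, bracket (p ^ n) (α (f i)) (α (g i))⟩ := by
      simp only [map_mul, hc', mul_mk_zero, Fin.sum_univ_four]
    have h3 : ∀ s : R, s = 0 ↔ (⟨0, s⟩ : Heis R p n) = 1 := by
      intro s
      constructor
      · rintro rfl; rfl
      · exact fun h => congrArg Heis.z h
    rw [h3, h3, ← h1, ← h2, map_eq_one_iff μ hμ, OneMemClass.coe_eq_one])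
  -- the range of `α` on `W`
  let αW : W →+ R := α.comp W.subtype
  have hαW : Function.Injective αW := by
    rw [injective_iff_map_eq_zero]
    intro f hf
    exact Subtype.ext (hinj f (hWY f.2) hf)
  have hfin : αW.range.FiniteIndex := by
    have h1 : αW.range = W.map α := by rw [AddMonoidHom.range_comp, AddSubgroup.range_subtype]
    have h2 : yProj μ.range = (yProj Δ).map α := by
      ext f
      constructor
      · rintro ⟨_, ⟨g, rfl⟩, rfl⟩
        exact ⟨_, ⟨g, g.2, rfl⟩, hα g⟩
      · rintro ⟨_, ⟨g, hg, rfl⟩, rfl⟩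
        exact ⟨_, ⟨⟨g, hg⟩, rfl⟩, (hα ⟨g, hg⟩).symm⟩
    have h3 : (W.map α).relIndex ((yProj Δ).map α) ≠ 0 := by
      rw [← AddSubgroup.relIndex_comap]
      exact fun h => (W.instFiniteIndex_addSubgroupOf (yProj Δ)).index_ne_zero
        (AddSubgroup.relIndex_eq_zero_of_le_left (AddSubgroup.le_comap_map α W) h)
    rw [h1]
    rw [← h2] at h3
    exact finiteIndex_of_relIndex h3
  obtain ⟨σ, a, b, ha, hb, hσ⟩ := exists_ringEquiv_of_monomial_relations (p := p) (n := n)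
    (AddMonoidHom.ofInjective hαW) (fun f₁ g₁ f₂ g₂ =>
      hmon f₁ f₁.2 g₁ g₁.2 f₂ f₂.2 g₂ g₂.2)
  replace hσ : ∀ f ∈ W, b * α f = a * σ f := fun f hf => hσ ⟨f, hf⟩
  -- The bracket is homogeneous of degree `e + 1`, whence the exponent on `a` and `b`.
  have hbr : ∀ f ∈ W, ∀ g ∈ W, b ^ (p ^ n + 1) * bracket (p ^ n) (α f) (α g) =
      a ^ (p ^ n + 1) * σ (bracket (p ^ n) f g) := by
    intro f hf g hg
    have h1 := hσ f hf
    have h2 := hσ g hg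
    have : b ^ (p ^ n + 1) * bracket (p ^ n) (α f) (α g) =
        bracket (p ^ n) (b * α f) (b * α g) := by
      simp only [bracket, mul_pow]; ring
    rw [this, h1, h2]
    simp only [bracket, mul_pow, map_sub, map_mul, map_pow]
    ring
  have hf1 := finiteIndex_comap_mul x W
  have hf2 := finiteIndex_comap_mul (x ^ p ^ n) W
  let W₂ : AddSubgroup R := W ⊓ W.comap (AddMonoidHom.mulLeft x) ⊓
    W.comap (AddMonoidHom.mulLeft (x ^ p ^ n))
  obtain ⟨g₀, hg₀, hg₀0⟩ := exists_ne_zero_mem W₂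
  have hD : (x ^ (p ^ n) ^ 2 - x) * g₀ ^ p ^ n ≠ 0 :=
    mul_ne_zero (sub_ne_zero.2 (hx 2 (by norm_num))) (pow_ne_zero _ hg₀0)
  -- For `f` in `W₂`, the central element with `z = (x ^ e ^ 2 - x) * g₀ ^ e * f` is a product of
  -- two commutators, so `α` determines its image.
  refine ⟨σ, a, b, W, W₂.map (AddMonoidHom.mulLeft ((x ^ (p ^ n) ^ 2 - x) * g₀ ^ p ^ n)),
    ha, hb, hW, ?_, fun g hg => ?_, ?_⟩
  · have h1 := hR _ hD
    have h2 : (W₂.map (AddMonoidHom.mulLeft ((x ^ (p ^ n) ^ 2 - x) * g₀ ^ p ^ n))).relIndex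
        (AddMonoidHom.mulLeft ((x ^ (p ^ n) ^ 2 - x) * g₀ ^ p ^ n)).range ≠ 0 := by
      rw [AddMonoidHom.range_eq_map, ← AddSubgroup.relIndex_comap, AddSubgroup.relIndex_top_right]
      exact (AddSubgroup.finiteIndex_of_le (AddSubgroup.le_comap_map _ W₂)).index_ne_zero
    exact finiteIndex_of_relIndex h2
  · rw [← hα]
    exact hσ _ hg
  · rintro g hgy ⟨f, ⟨⟨hf, hf'⟩, hf''⟩, hgz⟩
    obtain ⟨⟨hg, hg'⟩, hg''⟩ := hg₀
    change f ∈ W at hf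
    change x * f ∈ W at hf'
    change g₀ ∈ W at hg
    change x ^ p ^ n * g₀ ∈ W at hg''
    obtain ⟨F, hF, hFf⟩ := mem_yProj.1 (hWY hf)
    obtain ⟨F', hF', hFf'⟩ := mem_yProj.1 (hWY hf')
    obtain ⟨G, hG, hGf⟩ := mem_yProj.1 (hWY hg)
    obtain ⟨G', hG', hGf'⟩ := mem_yProj.1 (hWY hg'')
    let c₁ : Δ := ⟨F', hF'⟩ * ⟨G, hG⟩ * (⟨F', hF'⟩ : Δ)⁻¹ * (⟨G, hG⟩ : Δ)⁻¹
    let c₂ : Δ := ⟨G', hG'⟩ * ⟨F, hF⟩ * (⟨G', hG'⟩ : Δ)⁻¹ * (⟨F, hF⟩ : Δ)⁻¹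
    have e1 : (c₁ : Heis R p n) = ⟨0, bracket (p ^ n) (x * f) g₀⟩ := by
      have := commutator_eq F' G
      rw [hFf', hGf] at this
      exact this
    have e2 : (c₂ : Heis R p n) = ⟨0, bracket (p ^ n) (x ^ p ^ n * g₀) f⟩ := by
      have := commutator_eq G' F
      rw [hGf', hFf] at this
      exact this
    have hgc : g = c₁ * c₂ := by
      apply Subtype.ext
      rw [Subgroup.coe_mul, e1, e2, mul_mk_zero]
      ext
      · exact hgy
      · rw [← hgz]
        simp only [AddMonoidHom.coe_mulLeft, bracket, mul_pow, ← pow_mul, ← pow_two]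
        ring
    have e3 : μ c₁ = ⟨0, bracket (p ^ n) (α (x * f)) (α g₀)⟩ := by
      rw [map_commutator, ← hα, ← hα, hFf', hGf]
    have e4 : μ c₂ = ⟨0, bracket (p ^ n) (α (x ^ p ^ n * g₀)) (α f)⟩ := by
      rw [map_commutator, ← hα, ← hα, hGf', hFf]
    rw [hgc, map_mul, e3, e4, mul_mk_zero, Subgroup.coe_mul, e1, e2, mul_mk_zero, mul_add,
      hbr _ hf' _ hg, hbr _ hg'' _ hf, ← mul_add, ← map_add]

end Heis

end Heis

/-! ### The standard arithmetic subgroup and its isomorphisms -/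

section Standard

open Polynomial

variable {K : Type*} [Field K] {p : ℕ} [Fact p.Prime] [CharP K p] {n : ℕ}

/-- The group of integral points inside `G2`. -/
def Heis.emb : Heis K[X] p n →* G2 K⸨X⸩ p n where
  toFun g := mkG2 p n (invX K g.y) (invX K g.z)
  map_one' := by simp [mkG2_zero]
  map_mul' g h := by rw [mkG2_mul]; simp

lemma Heis.emb_injective : Function.Injective (emb : Heis K[X] p n →* G2 K⸨X⸩ p n) := by
  intro g h hgh
  ext1
  · exact invX_injective (congrArg yG2 hgh)
  · exact invX_injective (congrArg zG2 hgh)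

lemma Heis.range_emb : (emb : Heis K[X] p n →* G2 K⸨X⸩ p n).range =
    (GLminus K 3).subgroupOf (G2 K⸨X⸩ p n) := by
  ext g
  rw [Subgroup.mem_subgroupOf]
  constructor
  · rintro ⟨h, rfl⟩
    let Y : Fminus K := ⟨invX K h.y, (mem_Fminus_iff K).2 ⟨_, rfl⟩⟩
    let Z : Fminus K := ⟨invX K h.z, (mem_Fminus_iff K).2 ⟨_, rfl⟩⟩
    refine ⟨⟨!![1, Y ^ p ^ n, Z; 0, 1, Y; 0, 0, 1],
      !![1, -Y ^ p ^ n, Y ^ p ^ n * Y - Z; 0, 1, -Y; 0, 0, 1], ?_, ?_⟩, ?_⟩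
    · ext i j
      fin_cases i <;> fin_cases j <;> simp [Matrix.mul_apply, Fin.sum_univ_three]
      ring
    · ext i j
      fin_cases i <;> fin_cases j <;> simp [Matrix.mul_apply, Fin.sum_univ_three]
      ring
    · apply Units.ext
      ext i j : 2
      fin_cases i <;> fin_cases j <;> simp [emb, mkG2, Y, Z]
  · rintro ⟨h, hh⟩
    have hmem : ∀ i j, (g : GL (Fin 3) K⸨X⸩).1 i j ∈ Fminus K := by
      intro i j
      rw [← hh]
      exact (h.1 i j).2
    obtain ⟨Y, hY⟩ := (mem_Fminus_iff K).1 (hmem 1 2)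
    obtain ⟨Z, hZ⟩ := (mem_Fminus_iff K).1 (hmem 0 2)
    exact ⟨⟨Y, Z⟩, G2_ext hY hZ⟩

end Standard

/-! ### Trivializing homomorphisms on subgroups of finite index -/

lemma finiteIndex_comap_hom {G H : Type*} [Group G] [Group H] (f : G →* H) (U : Subgroup H)
    [U.FiniteIndex] : (U.comap f).FiniteIndex :=
  ⟨by rw [Subgroup.index_comap]; exact Subgroup.FiniteIndex.index_ne_zero (H := U.subgroupOf _)⟩

/-- A homomorphism to an `𝔽_p`-vector space that has finite image on a subgroup `C` vanishes on
the intersection of `C` with a subgroup of finite index. -/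
lemma exists_finiteIndex_trivial (p : ℕ) [Fact p.Prime] {D A : Type*} [Group D] [AddCommGroup A]
    [Module (ZMod p) A] (κ : D →* Multiplicative A) (C : Subgroup D)
    (h : (κ.comp C.subtype).ker.FiniteIndex) :
    ∃ E : Subgroup D, E.FiniteIndex ∧ ∀ g ∈ E, g ∈ C → κ g = 1 := by
  let N : AddSubgroup A := Subgroup.toAddSubgroup' (κ.comp C.subtype).range
  have hN : Finite N := by
    have h1 : Finite (κ.comp C.subtype).range := by
      apply Nat.finite_of_card_ne_zero
      rw [← Subgroup.index_ker]
      exact h.index_ne_zero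
    exact h1
  let N' : Submodule (ZMod p) A := AddSubgroup.toZModSubmodule p N
  have hN' : Finite N' := hN
  -- A linear retraction `π` onto the finite image of `C`: the kernel of `π ∘ κ` has finite index,
  -- and `π` is faithful on the image of `C`.
  obtain ⟨π, hπ⟩ := LinearMap.exists_leftInverse_of_injective N'.subtype
    (Submodule.ker_subtype _)
  let f : D →* Multiplicative N' := (AddMonoidHom.toMultiplicative π.toAddMonoidHom).comp κ
  refine ⟨f.ker, ⟨?_⟩, fun g hg hgC => ?_⟩
  · rw [Subgroup.index_ker]
    have : Finite (Multiplicative N') := hN'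
    exact Nat.card_pos.ne'
  · have h1 : π (κ g).toAdd = 0 := congrArg Multiplicative.toAdd hg
    have h2 := LinearMap.congr_fun hπ ⟨(κ g).toAdd, ⟨⟨g, hgC⟩, rfl⟩⟩
    change π (κ g).toAdd = _ at h2
    rw [h1] at h2
    exact congrArg Multiplicative.ofAdd (congrArg Subtype.val h2.symm)

/-! ### Extension from the integral points to the ambient group -/

section Standard

open Polynomial

variable {K : Type*} [Field K] {p : ℕ} [Fact p.Prime] [CharP K p] {n : ℕ}

/-- A homomorphism on a group of integral points that factors through the first coordinate extends
to a continuous additive map. -/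
lemma exists_continuous_addHom {D : Type*} [Group D] (u : D →* Heis K[X] p n)
    (κ : D →* Multiplicative K⸨X⸩) (h : ∀ g, (u g).y = 0 → κ g = 1) :
    ∃ κ' : K⸨X⸩ →+ K⸨X⸩, Continuous κ' ∧ ∀ g, κ' (invX K (u g).y) = (κ g).toAdd := by
  let _ : Module (ZMod p) K⸨X⸩ := (ZMod.algebra K⸨X⸩ p).toModule
  -- The open maximal ideal meets `F⁻` in zero, so `κ` can be factored through `F / m`; any additive
  -- map that vanishes on `m` is continuous.
  let m : AddSubgroup K⸨X⸩ :=
    { carrier := {s | Valued.v s < 1}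
      zero_mem' := by simp
      add_mem' := fun {a b} ha hb => (Valued.v.map_add a b).trans_lt (max_lt ha hb)
      neg_mem' := fun ha => by simpa [Valuation.map_neg] using ha }
  let m' : Submodule (ZMod p) K⸨X⸩ := AddSubgroup.toZModSubmodule p m
  have hm : ∀ f : K[X], invX K f ∈ m → f = 0 := by
    intro f hf
    by_contra h0
    change Valued.v (invX K f) < 1 at hf
    rw [valuation_invX h0, ← WithZero.exp_zero, WithZero.exp_lt_exp] at hf
    omega
  have hopen : IsOpen (m : Set K⸨X⸩) := by
    have h1 := Valued.isOpen_ball K⸨X⸩ 1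
    simp only [Valuation.restrict_lt_one_iff] at h1
    exact h1
  let q : K⸨X⸩ →+ (K⸨X⸩ ⧸ m') := m'.mkQ.toAddMonoidHom
  obtain ⟨α, hα⟩ := exists_addHom_factor p
    (((AddMonoidHom.toMultiplicative (q.comp (invX K : K[X] →+* K⸨X⸩).toAddMonoidHom))).comp
      (Heis.yHom.comp u)) κ (by
    intro g hg
    apply h
    apply hm
    have h1 : m'.mkQ (invX K (u g).y) = 0 := congrArg Multiplicative.toAdd hg
    rwa [Submodule.mkQ_apply, Submodule.Quotient.mk_eq_zero] at h1)
  refine ⟨α.comp q, ?_, hα⟩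
  apply continuous_of_continuousAt_zero
  rw [ContinuousAt, map_zero]
  refine tendsto_nhds_of_eventually_eq ?_
  filter_upwards [hopen.mem_nhds m.zero_mem] with s hs
  have : q s = 0 := (Submodule.Quotient.mk_eq_zero m').2 hs
  rw [AddMonoidHom.comp_apply, this, map_zero]

/-- Isomorphisms between subgroups of finite index of the group of integral points virtually
extend to `G2`. -/
theorem exists_extension [Finite K] (hn : p ^ n ≠ 1) (Δ : Subgroup (Heis K[X] p n))
    (μ : Δ →* Heis K[X] p n) [Δ.FiniteIndex] [μ.range.FiniteIndex]
    (hμ : Function.Injective μ) :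
    ∃ (Λ : G2 K⸨X⸩ p n ≃ₜ* G2 K⸨X⸩ p n) (E : Subgroup Δ), E.FiniteIndex ∧
      ∀ g ∈ E, Λ (g : Heis K[X] p n).emb = (μ g).emb := by
  obtain ⟨σ, a, b, V, Z, ha, hb, hV, hZ, hy, hz⟩ :=
    Heis.exists_ringEquiv hn finiteQuotients_polynomial X (by
      intro k hk h
      have h1 := congrArg natDegree h
      rw [natDegree_X_pow, natDegree_X, Nat.pow_eq_one] at h1
      exact hn (h1.resolve_right (by omega))) hμ
  obtain ⟨S, hS, hS', hSσ⟩ := exists_continuous_ringEquiv σ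
  have ha' : invX K a ≠ 0 := (map_ne_zero_iff _ invX_injective).2 ha
  have hb' : invX K b ≠ 0 := (map_ne_zero_iff _ invX_injective).2 hb
  set c : K⸨X⸩ := invX K a / invX K b with hc
  have hy' : ∀ g : Δ, (g : Heis K[X] p n).y ∈ V →
      invX K (μ g).y = c * S (invX K (g : Heis K[X] p n).y) := by
    intro g hg
    rw [hc, hSσ, div_mul_eq_mul_div, eq_div_iff hb', ← map_mul, ← map_mul, ← hy g hg, mul_comm]
  have hz' : ∀ g : Δ, (g : Heis K[X] p n).y = 0 → (g : Heis K[X] p n).z ∈ Z →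
      invX K (μ g).z = c ^ (p ^ n + 1) * S (invX K (g : Heis K[X] p n).z) := by
    intro g hg hg'
    rw [hc, hSσ, div_pow, div_mul_eq_mul_div, eq_div_iff (pow_ne_zero _ hb'), ← map_pow,
      ← map_pow, ← map_mul, ← map_mul, ← hz g hg hg', mul_comm]
  let D : Subgroup Δ := (AddSubgroup.toSubgroup V).comap (Heis.yHom.comp Δ.subtype)
  have hD : D.FiniteIndex := by
    have : (AddSubgroup.toSubgroup V).FiniteIndex := ⟨hV.index_ne_zero⟩
    exact finiteIndex_comap_hom _ _
  -- The defect in the coordinate `z`. It is a homomorphism because `y ↦ c * S y` multiplies the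
  -- cocycle `y ^ e * y'` by `c ^ (e + 1)` after applying `S`.
  let κ : D →* Multiplicative K⸨X⸩ :=
    { toFun := fun g => Multiplicative.ofAdd
        (invX K (μ g).z - c ^ (p ^ n + 1) * S (invX K (g : Heis K[X] p n).z))
      map_one' := by
        rw [← ofAdd_zero]
        simp
      map_mul' := fun g h => by
        rw [← ofAdd_add]
        congr 1
        simp only [Subgroup.coe_mul, map_mul, Heis.mul_z, map_add, map_pow, hy' g g.2, hy' h h.2]
        ring }
  let C : Subgroup D := (Heis.yHom.comp (Δ.subtype.comp D.subtype)).ker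
  let zC : C →* Multiplicative K[X] :=
    { toFun := fun g => Multiplicative.ofAdd (g : Heis K[X] p n).z
      map_one' := rfl
      map_mul' := fun g h => by
        have : (g : Heis K[X] p n).y = 0 := congrArg Multiplicative.toAdd g.2
        rw [← ofAdd_add]
        simp [this, zero_pow (pow_ne_zero n (Fact.out : p.Prime).ne_zero)] }
  have hker : (κ.comp C.subtype).ker.FiniteIndex := by
    have h1 : (AddSubgroup.toSubgroup Z).FiniteIndex := ⟨hZ.index_ne_zero⟩
    have h2 : ((AddSubgroup.toSubgroup Z).comap zC).FiniteIndex := finiteIndex_comap_hom _ _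
    refine Subgroup.finiteIndex_of_le (H := (AddSubgroup.toSubgroup Z).comap zC) fun g hg => ?_
    refine congrArg Multiplicative.ofAdd (sub_eq_zero.2 (hz' _ ?_ hg))
    exact congrArg Multiplicative.toAdd g.2
  let _ : Module (ZMod p) K⸨X⸩ := (ZMod.algebra K⸨X⸩ p).toModule
  -- On `E` the defect vanishes on the elements with `y = 0`, so it depends only on `y`.
  obtain ⟨E, hE, hEκ⟩ := exists_finiteIndex_trivial p κ C hker
  obtain ⟨κ', hκ', hκ''⟩ := exists_continuous_addHom
    (Δ.subtype.comp (D.subtype.comp E.subtype)) (κ.comp E.subtype) (fun g hg =>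
      hEκ g g.2 (congrArg Multiplicative.ofAdd hg))
  obtain ⟨Λ, hΛ⟩ := exists_continuousMulEquiv (p := p) (n := n) S hS hS' (div_ne_zero ha' hb')
    κ' hκ'
  refine ⟨Λ, E.map D.subtype, ⟨?_⟩, ?_⟩
  · rw [Subgroup.index_map_subtype]
    exact mul_ne_zero hE.index_ne_zero hD.index_ne_zero
  · rintro _ ⟨g, hg, rfl⟩
    have h1 := hκ'' ⟨g, hg⟩
    rw [hΛ]
    apply G2_ext
    · exact (hy' g g.2).symm
    · refine (congrArg (_ + ·) h1).trans ?_
      exact add_sub_cancel _ _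

end Standard

/-! ### Rigidity for `e > 1` -/

/-- If `H` is commensurable with the images of two embeddings of `A` into `G`, the
correspondence between these images restricts to an isomorphism between subgroups of finite index
of `H`. -/
lemma exists_correspondence {G H A : Type*} [Group G] [Group H] [Group A] (i : H →* G)
    (j l : A →* G) (hi : Function.Injective i) (hj : Function.Injective j)
    (hl : Function.Injective l) (hij : i.range.relIndex j.range ≠ 0)
    (hji : j.range.relIndex i.range ≠ 0) (hil : i.range.relIndex l.range ≠ 0)
    (hli : l.range.relIndex i.range ≠ 0) :
    ∃ (Δ : Subgroup H) (μ : Δ →* H), Δ.FiniteIndex ∧ μ.range.FiniteIndex ∧ Function.Injective μ ∧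
      ∀ h : Δ, ∃ d, j d = i h ∧ l d = i (μ h) := by
  have key : ∀ j l : A →* G, Function.Injective j → j.range.relIndex i.range ≠ 0 →
      i.range.relIndex l.range ≠ 0 → (((i.range.comap l).map j).comap i).FiniteIndex := by
    intro j l hj h1 h2
    refine ⟨?_⟩
    rw [Subgroup.index_comap]
    refine Subgroup.relIndex_ne_zero_trans ?_ h1
    rw [MonoidHom.range_eq_map j, Subgroup.relIndex_map_map_of_injective _ _ hj,
      Subgroup.relIndex_top_right, Subgroup.index_comap]
    exact h2
  let Δ : Subgroup H := ((i.range.comap l).map j).comap i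
  have hΔ : ∀ h : Δ, ∃ d k, j d = i h ∧ l d = i k := by
    rintro ⟨h, d, ⟨k, hk⟩, hd⟩
    exact ⟨d, k, hd, hk.symm⟩
  choose d k hd hk using hΔ
  have hdm : ∀ g h, d (g * h) = d g * d h := fun g h => hj (by
    rw [map_mul, hd, hd, hd, Subgroup.coe_mul, map_mul])
  let μ : Δ →* H := MonoidHom.mk' k fun g h => hi (by
    rw [map_mul, ← hk, ← hk, ← hk, hdm, map_mul])
  refine ⟨Δ, μ, key j l hj hji hil, ?_, ?_, fun h => ⟨d h, hd h, hk h⟩⟩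
  -- The range of `μ` contains the domain of the inverse correspondence, obtained by exchanging `j`
  -- and `l`.
  · have := key l j hl hli hij
    refine Subgroup.finiteIndex_of_le (H := ((i.range.comap j).map l).comap i) ?_
    rintro k' ⟨d', ⟨h, hh⟩, hd'⟩
    refine ⟨⟨h, d', ⟨k', hd'.symm⟩, hh.symm⟩, hi ?_⟩
    refine (hk _).symm.trans ((congrArg l (hj ?_)).trans hd')
    exact (hd _).trans hh
  · intro g h hgh
    have h1 : l (d g) = l (d h) := by rw [hk, hk]; exact congrArg i hgh
    have h2 : i g = i h := by rw [← hd, ← hd, hl h1]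
    exact Subtype.ext (hi h2)

lemma relIndex_range_comp_subtype {G A : Type*} [Group G] [Group A] {Γ Γ₀ : Subgroup G}
    (h1 : Γ.relIndex Γ₀ ≠ 0) (h2 : Γ₀.relIndex Γ ≠ 0) (j : A →* Γ) (hj : j.range.FiniteIndex) :
    (Γ.subtype.comp j).range.relIndex Γ₀ ≠ 0 ∧ Γ₀.relIndex (Γ.subtype.comp j).range ≠ 0 := by
  have h3 : (Γ.subtype.comp j).range ≤ Γ := by
    rintro _ ⟨a, rfl⟩
    exact (j a).2
  refine ⟨Subgroup.relIndex_ne_zero_trans ?_ h1, Subgroup.relIndex_ne_zero_trans h2 ?_⟩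
  · have h4 : (Γ.subtype.comp j).range.subgroupOf Γ = j.range := by
      rw [MonoidHom.range_comp]
      exact Subgroup.comap_map_eq_self_of_injective Γ.subtype_injective _
    rw [Subgroup.relIndex, h4]
    exact hj.index_ne_zero
  · rw [Subgroup.relIndex_eq_one.2 h3]
    exact one_ne_zero

/-- The inclusion of `lam.dom` and `lam` itself embed the same group in `G2`, both with image
commensurable with the integral points. This transports `lam` to a map to which `exists_extension`
applies. -/
theorem automorphismRigid_of_ne_one (p : ℕ) [Fact p.Prime] (K : Type*) [Field K] [Finite K]
    [CharP K p] (n : ℕ) (hn : p ^ n ≠ 1) (Γ : Subgroup (G2 K⸨X⸩ p n)) (hΓ : IsArithmetic Γ)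
    [DiscreteTopology Γ] : AutomorphismRigid Γ := by
  intro lam
  obtain ⟨h1, h2⟩ := hΓ
  rw [← Heis.range_emb] at h1 h2
  let l : lam.dom →* Γ := lam.cod.subtype.comp lam.iso.toMulEquiv.toMonoidHom
  have hj := relIndex_range_comp_subtype h1 h2 lam.dom.subtype (by rw [Subgroup.range_subtype]; exact lam.dom_finiteIndex)
  have hl := relIndex_range_comp_subtype h1 h2 l (by
    have : l.range = lam.cod := by
      rw [MonoidHom.range_comp, MonoidHom.range_eq_top.2 lam.iso.surjective,
        ← MonoidHom.range_eq_map, Subgroup.range_subtype]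
    rw [this]
    exact lam.cod_finiteIndex)
  have hj' : Function.Injective (Γ.subtype.comp lam.dom.subtype) :=
    Γ.subtype_injective.comp lam.dom.subtype_injective
  have hl' : Function.Injective (Γ.subtype.comp l) :=
    Γ.subtype_injective.comp (lam.cod.subtype_injective.comp lam.iso.injective)
  obtain ⟨Δ, μ, hΔ, hμ, hμ', hcor⟩ := exists_correspondence _ _ _ Heis.emb_injective
    hj' hl' hj.2 hj.1 hl.2 hl.1
  obtain ⟨Λ, E, hE, hΛ⟩ := exists_extension hn Δ μ hμ'
  refine ⟨VirtualIso.ofEquiv Λ, ((E.map Δ.subtype).map Heis.emb).subgroupOf Γ, ⟨?_⟩,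
    isOpen_discrete _, ?_⟩
  · refine Subgroup.relIndex_ne_zero_trans ?_ h2
    rw [MonoidHom.range_eq_map, Subgroup.relIndex_map_map_of_injective _ _ Heis.emb_injective,
      Subgroup.relIndex_top_right, Subgroup.index_map_subtype]
    exact mul_ne_zero hE.index_ne_zero hΔ.index_ne_zero
  · rintro γ ⟨_, ⟨g, hg, rfl⟩, hgγ⟩
    obtain ⟨d, hd, hd'⟩ := hcor g
    have hdγ : (d : Γ) = γ := Subtype.ext (hd.trans hgγ)
    subst hdγ
    refine ⟨d.2, trivial, ?_⟩
    change Λ (d : Γ) = _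
    refine (congrArg Λ hd).trans ((hΛ g hg).trans hd'.symm)

/-! ### Rigidity for `e = 1` -/

section Abelian

variable {G : Type*} [CommGroup G] {Γ U : Subgroup G}

/-- The multiplication map on the product of a subgroup of `Γ` and `U`. -/
def prodHom (A : Subgroup Γ) (U : Subgroup G) : A × U →* G :=
  (Γ.subtype.comp A.subtype).coprod U.subtype

lemma prodHom_injective (A : Subgroup Γ) (hU' : U ⊓ Γ = ⊥) :
    Function.Injective (prodHom A U) := by
  rw [injective_iff_map_eq_one]
  rintro ⟨a, u⟩ h
  have h1 : ((a : Γ) : G) * u = 1 := h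
  have h2 : (u : G) ∈ U ⊓ Γ := ⟨u.2, by
    rw [← inv_eq_of_mul_eq_one_right h1]
    exact Γ.inv_mem (a : Γ).2⟩
  rw [hU', Subgroup.mem_bot] at h2
  rw [h2, mul_one] at h1
  exact Prod.ext (Subtype.ext (Subtype.ext h1)) (Subtype.ext h2)

lemma le_range_prodHom (A : Subgroup Γ) : U ≤ (prodHom A U).range :=
  fun u hu => ⟨(1, ⟨u, hu⟩), by simp [prodHom]⟩

variable [TopologicalSpace G] [IsTopologicalGroup G]

lemma isOpen_range_prodHom (A : Subgroup Γ) (hU : IsOpen (U : Set G)) :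
    IsOpen ((prodHom A U).range : Set G) :=
  Subgroup.isOpen_mono (le_range_prodHom A) hU

/-- The quotient by the open subgroup `Γ ⊔ R` is discrete, and compact as an image of `G ⧸ Γ`, hence
finite. The index of `R` in `Γ ⊔ R` is controlled by that of `A` in `Γ`. -/
lemma finiteIndex_range_prodHom (A : Subgroup Γ) [hA : A.FiniteIndex] (hU : IsOpen (U : Set G))
    [CompactSpace (G ⧸ Γ)] : (prodHom A U).range.FiniteIndex := by
  set R := (prodHom A U).range
  have hR : IsOpen (R : Set G) := isOpen_range_prodHom A hU
  have hT : IsOpen ((Γ ⊔ R : Subgroup G) : Set G) := Subgroup.isOpen_mono le_sup_right hR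
  have h1 : R.relIndex (Γ ⊔ R) ≠ 0 := by
    rw [Subgroup.relIndex_sup_right]
    have h2 : (A.map Γ.subtype).relIndex Γ = A.index := by
      rw [Subgroup.relIndex, Subgroup.subgroupOf,
        Subgroup.comap_map_eq_self_of_injective Γ.subtype_injective]
    have h3 : A.map Γ.subtype ≤ R := by
      rintro _ ⟨a, ha, rfl⟩
      exact ⟨(⟨a, ha⟩, 1), by simp [prodHom]⟩
    intro h0
    have h4 := Subgroup.relIndex_dvd_of_le_left Γ h3
    rw [h0, h2, zero_dvd_iff] at h4
    exact hA.index_ne_zero h4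
  have h2 : (Γ ⊔ R).FiniteIndex := by
    have : DiscreteTopology (G ⧸ (Γ ⊔ R)) := QuotientGroup.discreteTopology hT
    have hc : Continuous (QuotientGroup.map Γ (Γ ⊔ R) (MonoidHom.id G) le_sup_left) :=
      continuous_quot_lift _ QuotientGroup.continuous_mk
    have hs : Function.Surjective (QuotientGroup.map Γ (Γ ⊔ R) (MonoidHom.id G) le_sup_left) := by
      intro g
      obtain ⟨g, rfl⟩ := QuotientGroup.mk_surjective g
      exact ⟨QuotientGroup.mk g, rfl⟩
    have : CompactSpace (G ⧸ (Γ ⊔ R)) := hs.compactSpace hc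
    have : Finite (G ⧸ (Γ ⊔ R)) := finite_of_compact_of_discrete
    exact Subgroup.finiteIndex_of_finite_quotient
  refine ⟨?_⟩
  rw [← Subgroup.relIndex_top_right]
  refine Subgroup.relIndex_ne_zero_trans h1 ?_
  rw [Subgroup.relIndex_top_right]
  exact h2.index_ne_zero

lemma continuous_of_eq_on {R : Subgroup G} (f : R →* G) (hU : IsOpen (U : Set G)) (hUR : U ≤ R)
    (hf : ∀ u (hu : u ∈ U), f ⟨u, hUR hu⟩ = u) : Continuous f := by
  apply continuous_of_continuousAt_one
  refine (continuous_subtype_val.continuousAt).congr ?_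
  have : (R.subtype ⁻¹' (U : Set G)) ∈ nhds (1 : R) :=
    (hU.preimage continuous_subtype_val).mem_nhds U.one_mem
  filter_upwards [this] with r hr
  exact (hf r hr).symm

/-- The extension is `lam` on its domain times the identity on `U`. Both it and its inverse are the
identity on the open subgroup `U`, which gives continuity. -/
theorem automorphismRigid_of_comm (hU : IsOpen (U : Set G)) (hU' : U ⊓ Γ = ⊥)
    [CompactSpace (G ⧸ Γ)] : AutomorphismRigid Γ := by
  intro lam
  have := lam.dom_finiteIndex
  have := lam.cod_finiteIndex
  let e₁ := MonoidHom.ofInjective (prodHom_injective lam.dom hU')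
  let e₂ := MonoidHom.ofInjective (prodHom_injective lam.cod hU')
  let e : (prodHom lam.dom U).range ≃* (prodHom lam.cod U).range :=
    e₁.symm.trans ((lam.iso.toMulEquiv.prodCongr (MulEquiv.refl U)).trans e₂)
  have he : ∀ d u, e (e₁ (d, u)) = e₂ (lam.iso d, u) := fun d u => by
    simp only [e, MulEquiv.trans_apply, MulEquiv.symm_apply_apply]
    rfl
  have he' : ∀ d u, e.symm (e₂ (lam.iso d, u)) = e₁ (d, u) := fun d u => by
    rw [← he, MulEquiv.symm_apply_apply]
  have hu₁ : ∀ u (hu : u ∈ U), (⟨u, le_range_prodHom lam.dom hu⟩ : (prodHom lam.dom U).range) =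
      e₁ (1, ⟨u, hu⟩) := fun u hu => Subtype.ext (one_mul u).symm
  have hu₂ : ∀ u (hu : u ∈ U), (⟨u, le_range_prodHom lam.cod hu⟩ : (prodHom lam.cod U).range) =
      e₂ (lam.iso 1, ⟨u, hu⟩) := fun u hu => Subtype.ext (by
    rw [map_one]; exact (one_mul u).symm)
  refine ⟨⟨(prodHom lam.dom U).range, (prodHom lam.cod U).range,
    finiteIndex_range_prodHom _ hU, isOpen_range_prodHom _ hU,
    finiteIndex_range_prodHom _ hU, isOpen_range_prodHom _ hU,
    { e with
      continuous_toFun := ?_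
      continuous_invFun := ?_ }⟩, lam.dom, lam.dom_finiteIndex, lam.dom_isOpen, fun γ hγ => ?_⟩
  · refine continuous_induced_rng.2 (continuous_of_eq_on
      ((prodHom lam.cod U).range.subtype.comp e.toMonoidHom) hU (le_range_prodHom _) ?_)
    intro u hu
    rw [hu₁ u hu]
    refine (congrArg Subtype.val (he 1 ⟨u, hu⟩)).trans ?_
    rw [← hu₂]
  · refine continuous_induced_rng.2 (continuous_of_eq_on
      ((prodHom lam.dom U).range.subtype.comp e.symm.toMonoidHom) hU (le_range_prodHom _) ?_)
    intro u hu
    rw [hu₂ u hu]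
    refine (congrArg Subtype.val (he' 1 ⟨u, hu⟩)).trans ?_
    rw [← hu₁]
  · have h1 : (γ : G) = prodHom lam.dom U (⟨γ, hγ⟩, 1) := (mul_one (γ : G)).symm
    refine ⟨hγ, ⟨_, h1.symm⟩, ?_⟩
    have h2 : (⟨γ, ⟨_, h1.symm⟩⟩ : (prodHom lam.dom U).range) = e₁ (⟨γ, hγ⟩, 1) :=
      Subtype.ext h1
    change ((e _ : (prodHom lam.cod U).range) : G) = _
    rw [h2, he]
    exact mul_one _

end Abelian

/-- The open subgroups of `G2` form a neighbourhood basis of the identity. -/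
lemma exists_open_subgroup {F : Type*} [Field F] {Γ₀ : Type*} [LinearOrderedCommGroupWithZero Γ₀]
    [Valued F Γ₀] {p : ℕ} [Fact p.Prime] [CharP F p] {n : ℕ} {W : Set (G2 F p n)}
    (hW : W ∈ nhds 1) : ∃ U : Subgroup (G2 F p n), IsOpen (U : Set (G2 F p n)) ∧ (U : Set _) ⊆ W := by
  set w := (Valued.v : Valuation F Γ₀).restrict with hw
  have h1 : (fun q : F × F => mkG2 p n q.1 q.2) ⁻¹' W ∈ nhds ((0, 0) : F × F) := by
    apply (continuous_mkG2 (p := p) (n := n)).continuousAt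
    simp only [mkG2_zero]
    exact hW
  rw [nhds_prod_eq, Filter.mem_prod_same_iff] at h1
  obtain ⟨T, hT, hTW⟩ := h1
  obtain ⟨r, hr⟩ := Valued.mem_nhds_zero.1 hT
  -- Capping the radius at `1` keeps the term `y ^ e * y'` of the product within the ball.
  have hs1 : min (r : MonoidWithZeroHom.ValueGroup₀ (.ofClass (Valued.v : Valuation F Γ₀))) 1 ≤ 1 :=
    min_le_right _ _
  have hs0 : 0 < min (r : MonoidWithZeroHom.ValueGroup₀ (.ofClass (Valued.v : Valuation F Γ₀))) 1 :=
    lt_min (zero_lt_iff.2 r.ne_zero) zero_lt_one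
  have hsr := min_le_left (r : MonoidWithZeroHom.ValueGroup₀ (.ofClass (Valued.v : Valuation F Γ₀))) 1
  generalize min (r : MonoidWithZeroHom.ValueGroup₀ (.ofClass (Valued.v : Valuation F Γ₀))) 1 = s
    at hs1 hs0 hsr
  have hmul : ∀ y y' : F, w y < s → w y' < s → w (y ^ p ^ n * y') < s := by
    intro y y' hy hy'
    rw [map_mul, map_pow]
    exact (mul_le_of_le_one_left' (pow_le_one' (hy.le.trans hs1) _)).trans_lt hy'
  let U : Subgroup (G2 F p n) :=
    { carrier := {g | w (yG2 g) < s ∧ w (zG2 g) < s}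
      one_mem' := by simp [hs0]
      mul_mem' := fun {g h} hg hh => by
        refine ⟨?_, ?_⟩
        · rw [yG2_mul]
          exact w.map_add_lt hg.1 hh.1
        · rw [zG2_mul]
          exact w.map_add_lt (w.map_add_lt hg.2 hh.2) (hmul _ _ hg.1 hh.1)
      inv_mem' := fun {g} hg => by
        refine ⟨?_, ?_⟩
        · rw [yG2_inv, Valuation.map_neg]
          exact hg.1
        · rw [zG2_inv]
          exact w.map_sub_lt (hmul _ _ hg.1 hg.1) hg.2 }
  refine ⟨U, ?_, fun g hg => ?_⟩
  · exact ((Valued.isOpen_ball F s).preimage continuous_yG2).inter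
      ((Valued.isOpen_ball F s).preimage continuous_zG2)
  · rw [← mk_yG2_zG2 g]
    exact hTW (Set.mk_mem_prod (hr (hg.1.trans_le hsr)) (hr (hg.2.trans_le hsr)))

/-- For `e = 1` the cocycle `y * y'` is symmetric, so the group is commutative; discreteness of `Γ`
provides the open subgroup that meets it trivially. -/
theorem automorphismRigid_of_eq_one (p : ℕ) [Fact p.Prime] (K : Type*) [Field K] [CharP K p] (n : ℕ)
    (hn : p ^ n = 1) (Γ : Subgroup (G2 K⸨X⸩ p n)) [DiscreteTopology Γ]
    [hΓ : CompactSpace (G2 K⸨X⸩ p n ⧸ Γ)] : AutomorphismRigid Γ := by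
  let _ : CommGroup (G2 K⸨X⸩ p n) :=
    { (inferInstance : Group (G2 K⸨X⸩ p n)) with
      mul_comm := fun g h => G2_ext (by rw [yG2_mul, yG2_mul, add_comm]) (by
        rw [zG2_mul, zG2_mul, hn]; ring) }
  obtain ⟨W, hW, hWΓ⟩ := isOpen_induced_iff.1 (isOpen_discrete ({1} : Set Γ))
  have h1 : (1 : Γ) ∈ Subtype.val ⁻¹' W := by rw [hWΓ]; rfl
  obtain ⟨U, hU, hUW⟩ := exists_open_subgroup (hW.mem_nhds h1)
  refine automorphismRigid_of_comm hU ?_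
  rw [eq_bot_iff]
  rintro g ⟨hgU, hgΓ⟩
  have h2 : (⟨g, hgΓ⟩ : Γ) ∈ Subtype.val ⁻¹' W := hUW hgU
  rw [hWΓ] at h2
  exact congrArg Subtype.val h2

end ArithUnip

end

theorem mainTheorem4 (p : ℕ) [Fact p.Prime] (K : Type*) [Field K] [Finite K] [CharP K p]
    (n : ℕ) (hn : p ^ n ≠ 2)
    (Γ : Subgroup (ArithUnip.G2 (LaurentSeries K) p n))
    (hΓ : ArithUnip.IsArithmetic Γ) (hΓ' : ArithUnip.IsLattice Γ) :
    ArithUnip.AutomorphismRigid Γ := by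
  have := hΓ'.1
  by_cases h : p ^ n = 1
  · have := hΓ'.2
    exact ArithUnip.automorphismRigid_of_eq_one p K n h Γ
  · exact ArithUnip.automorphismRigid_of_ne_one p K n h Γ hΓ
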